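/- Let $K$ be a field of characteristic $0$ and $N\ge 4$. Let $K\{u\}$ be the algebra of differential polynomials in $u_0,\dots,u_{N-2}$, with derivation $\partial=d/dx$, and let $$L=\partial^N+\sum_{i=0}^{N-2}u_i\,\partial^{N-2-i}.$$ Let $L^{1/N}=\partial+\cdots$ be the monic first-order formal pseudodifferential operator over $K\{u\}$ whose $N$-th power is $L$. For $n=2,3$ put $P_n=\big((L^{1/N})^n\big)_+$ (differential part) and let $X_n$ be the evolution derivation $L_t=X_n(L)=[P_n,L]$. For constants $\alpha,\gamma,a,b,f,g\in K$ consider the scalar linear extensions of these two flows given by $$\varphi_t=\mathcal A_2(\varphi),\quad \mathcal A_2=\alpha u_0+\gamma\partial^2,\qquad\qquad \varphi_t=\mathcal A_3(\varphi),\quad \mathcal A_3=(a\,\partial(u_0)+b\,u_1)+f\,u_0\,\partial+g\,\partial^3,$$ that is, the evolution derivations $X_n^{\rm ext}$ ($n=2,3$) of $K\{u,\varphi\}$ which prolong $X_n$ by $\varphi\mapsto\mathcal A_n(\varphi)$. Call the pair of extensions decomposed if neither $\mathcal A_2$ nor $\mathcal A_3$ involves $u$ (both have constant coefficients). Let $\dagger$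 denote the formal adjoint. Then $X_2^{\rm ext}$ and $X_3^{\rm ext}$ commute and the pair is not decomposed if and only if one of the following holds: 1. $\gamma=1$ and $\mathcal A_n=P_n$ for $n=2,3$ (the Lax-type extension); 2. $\gamma=-1$ and $\mathcal A_n=-P_n^\dagger$ for $n=2,3$ (the dual of the Lax-type extension). Both cases occur: $\mathcal A_n=P_n$ $(n=2,3)$ for $$\alpha=\tfrac2N,\quad \gamma=1,\quad a=\tfrac{3(3-N)}{2N},\quad b=\tfrac3N,\quad f=\tfrac3N,\quad g=1,$$ and $\mathcal A_n=-P_n^\dagger$ $(n=2,3)$ for $$\alpha=-\tfrac2N,\quad \gamma=-1,\quad a=\tfrac{3(N-1)}{2N},\quad b=-\tfrac3N,\quad f=\tfrac3N,\quad g=1.$$ -/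

import Mathlib

noncomputable section

/-! ### Formal pseudodifferential operators over a commutative differential ring -/

/-- The families `i ↦ aᵢ` (`i ∈ ℤ`) in `R` whose support is bounded above. -/
def boundedAbove (R : Type*) [CommRing R] : AddSubgroup (ℤ → R) where
  carrier := {c | ∃ m : ℤ, ∀ i, m < i → c i = 0}
  zero_mem' := ⟨0, fun _ _ => rfl⟩
  add_mem' := by
    rintro c d ⟨m, hm⟩ ⟨n, hn⟩
    refine ⟨max m n, fun i hi => ?_⟩
    simp [hm i (lt_of_le_of_lt (le_max_left _ _) hi), hn i (lt_of_le_of_lt (le_max_right _ _) hi)]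
  neg_mem' := by
    rintro c ⟨m, hm⟩
    exact ⟨m, fun i hi => by simp [hm i hi]⟩

/-- Formal pseudodifferential operators `∑_{i ≤ m} aᵢ ∂ⁱ` over `R`, given by their families of
coefficients `i ↦ aᵢ`. -/
def PsiDO (R : Type*) [CommRing R] : Type _ := boundedAbove R

namespace PsiDO

variable {R : Type*} [CommRing R]

instance : AddCommGroup (PsiDO R) := inferInstanceAs (AddCommGroup (boundedAbove R))

/-- The coefficient of `∂ⁱ`. -/
def coeff (P : PsiDO R) (i : ℤ) : R := P.1 i

/-- The operator `a ∂ⁱ`. -/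
def mono (a : R) (i : ℤ) : PsiDO R :=
  ⟨fun j => if j = i then a else 0, i, fun _ hj => if_neg (ne_of_gt hj)⟩

instance : One (PsiDO R) := ⟨mono 1 0⟩

/-- The differential part `P₊ = ∑_{i ≥ 0} aᵢ ∂ⁱ` of `P = ∑ aᵢ ∂ⁱ`. -/
def plus (P : PsiDO R) : PsiDO R :=
  ⟨fun i => if 0 ≤ i then P.coeff i else 0, by
    obtain ⟨c, m, hm⟩ := P
    refine ⟨m, fun i hi => ?_⟩
    simp [coeff, hm i hi]⟩

/-- All coefficients in positions above `m` vanish. -/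
def OrdLE (P : PsiDO R) (m : ℤ) : Prop := ∀ i, m < i → P.coeff i = 0

theorem exists_ordLE (P : PsiDO R) : ∃ m, P.OrdLE m := P.2

theorem ext_coeff {P Q : PsiDO R} (h : ∀ i, P.coeff i = Q.coeff i) : P = Q :=
  Subtype.ext (funext h)

theorem coeff_add (P Q : PsiDO R) (i : ℤ) : (P + Q).coeff i = P.coeff i + Q.coeff i := rfl

theorem coeff_mono (a : R) (i j : ℤ) : (mono a i).coeff j = if j = i then a else 0 := rfl

theorem coeff_sum {κ : Type*} (s : Finset κ) (P : κ → PsiDO R) (i : ℤ) :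
    (∑ k ∈ s, P k).coeff i = ∑ k ∈ s, (P k).coeff i :=
  map_sum (AddMonoidHom.mk' (fun P : PsiDO R => P.coeff i) fun _ _ => rfl) P s

theorem OrdLE.add {P Q : PsiDO R} {a : ℤ} (hP : P.OrdLE a) (hQ : Q.OrdLE a) :
    (P + Q).OrdLE a := fun i hi => by rw [coeff_add, hP i hi, hQ i hi, add_zero]

variable [Differential R]

/-- The product of pseudodifferential operators, the bilinear extension of
`(a ∂ⁱ)(b ∂ʲ) = ∑_{k ≥ 0} binom(i, k) a b⁽ᵏ⁾ ∂^{i+j-k}`; the term of index `(i, k)` below is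
the contribution of `j = m - i + k` to the coefficient of `∂ᵐ`. Only finitely many terms of
each sum are nonzero. -/
instance : Mul (PsiDO R) where
  mul P Q := ⟨fun m => ∑ᶠ p : ℤ × ℕ, Ring.choose p.1 p.2 •
      (P.coeff p.1 * (⇑(Differential.deriv (R := R)))^[p.2] (Q.coeff (m - p.1 + p.2))), by
    obtain ⟨c, a, ha⟩ := P
    obtain ⟨d, b, hb⟩ := Q
    refine ⟨a + b, fun m hm => finsum_eq_zero_of_forall_eq_zero fun p => ?_⟩
    rcases lt_or_ge a p.1 with h | h
    · simp [coeff, ha _ h]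
    · have : b < m - p.1 + p.2 := by omega
      simp [coeff, hb _ this]⟩

instance : Pow (PsiDO R) ℕ := ⟨fun P n => npowRec n P⟩

/-- The commutator `[P, Q] = P Q - Q P`. -/
def comm (P Q : PsiDO R) : PsiDO R := P * Q - Q * P

/-- The formal adjoint `P† = ∑ (-∂)ⁱ aᵢ` of `P = ∑ aᵢ ∂ⁱ`, expanded through
`∂ⁱ a = ∑_{k ≥ 0} binom(i, k) a⁽ᵏ⁾ ∂^{i-k}`. -/
def adjoint (P : PsiDO R) : PsiDO R :=
  ⟨fun m => ∑ᶠ k : ℕ, (((m + k).negOnePow : ℤ) * Ring.choose (m + k : ℤ) k) •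
      (⇑(Differential.deriv (R := R)))^[k] (P.coeff (m + k)), by
    obtain ⟨c, a, ha⟩ := P
    refine ⟨a, fun m hm => finsum_eq_zero_of_forall_eq_zero fun k => ?_⟩
    have : a < m + k := by omega
    simp [coeff, ha _ this]⟩

/-- `S` is a monic first-order `N`-th root of `L`: `S = ∂ + s₀ + s₁ ∂⁻¹ + ⋯` and `S ^ N = L`. -/
def IsMonicRoot (N : ℕ) (L S : PsiDO R) : Prop :=
  S.OrdLE 1 ∧ S.coeff 1 = 1 ∧ S ^ N = L
/-! Existence and uniqueness of the monic root. -/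

theorem coeff_mul (P Q : PsiDO R) (m : ℤ) : (P * Q).coeff m = ∑ᶠ p : ℤ × ℕ, Ring.choose p.1 p.2 •
    (P.coeff p.1 * (⇑(Differential.deriv (R := R)))^[p.2] (Q.coeff (m - p.1 + p.2))) := rfl

theorem iterate_deriv_add (k : ℕ) (x y : R) : (⇑(Differential.deriv (R := R)))^[k] (x + y) =
    (⇑(Differential.deriv (R := R)))^[k] x + (⇑(Differential.deriv (R := R)))^[k] y := by
  induction k generalizing x y with
  | zero => rfl
  | succ k ih => simp [Function.iterate_succ_apply, ih]

theorem mul_term_eq_zero {P Q : PsiDO R} {a b : ℤ} (hP : P.OrdLE a) (hQ : Q.OrdLE b) (m : ℤ)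
    (p : ℤ × ℕ) (h : a < p.1 ∨ b < m - p.1 + p.2) : Ring.choose p.1 p.2 •
      (P.coeff p.1 * (⇑(Differential.deriv (R := R)))^[p.2] (Q.coeff (m - p.1 + p.2))) = 0 := by
  rcases h with h | h
  · simp [hP _ h]
  · simp [hQ _ h]

theorem mul_support_finite (P Q : PsiDO R) (m : ℤ) : (Function.support fun p : ℤ × ℕ =>
    Ring.choose p.1 p.2 • (P.coeff p.1 *
      (⇑(Differential.deriv (R := R)))^[p.2] (Q.coeff (m - p.1 + p.2)))).Finite := by
  obtain ⟨a, ha⟩ := exists_ordLE P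
  obtain ⟨b, hb⟩ := exists_ordLE Q
  refine ((Set.finite_Icc (m - b) a).prod (Set.finite_Iic (b - m + a).toNat)).subset ?_
  intro p hp
  by_contra hcon
  refine hp (mul_term_eq_zero ha hb m p ?_)
  simp only [Set.mem_prod, Set.mem_Icc, Set.mem_Iic] at hcon
  omega

theorem add_mul' (P Q S : PsiDO R) : (P + Q) * S = P * S + Q * S := by
  refine ext_coeff fun m => ?_
  rw [coeff_add, coeff_mul, coeff_mul, coeff_mul,
    ← finsum_add_distrib (mul_support_finite P S m) (mul_support_finite Q S m)]
  simp only [coeff_add, add_mul, smul_add]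

theorem mul_add' (P Q S : PsiDO R) : P * (Q + S) = P * Q + P * S := by
  refine ext_coeff fun m => ?_
  rw [coeff_add, coeff_mul, coeff_mul, coeff_mul,
    ← finsum_add_distrib (mul_support_finite P Q m) (mul_support_finite P S m)]
  simp only [coeff_add, iterate_deriv_add, mul_add, smul_add]

theorem OrdLE.mul {P Q : PsiDO R} {a b : ℤ} (hP : P.OrdLE a) (hQ : Q.OrdLE b) :
    (P * Q).OrdLE (a + b) := by
  intro m hm
  rw [coeff_mul]
  refine finsum_eq_zero_of_forall_eq_zero fun p => mul_term_eq_zero hP hQ m p ?_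
  omega

theorem OrdLE.coeff_mul {P Q : PsiDO R} {a b : ℤ} (hP : P.OrdLE a) (hQ : Q.OrdLE b) :
    (P * Q).coeff (a + b) = P.coeff a * Q.coeff b := by
  rw [PsiDO.coeff_mul, finsum_eq_single _ ((a, 0) : ℤ × ℕ)]
  · simp
  · intro p hp
    refine mul_term_eq_zero hP hQ _ p ?_
    by_contra hcon
    apply hp
    ext <;> simp <;> omega

theorem pow_succ' (P : PsiDO R) (n : ℕ) : P ^ (n + 1) = P ^ n * P := rfl

theorem pow_monic {S : PsiDO R} (h1 : S.OrdLE 1) (h2 : S.coeff 1 = 1) (n : ℕ) :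
    (S ^ n).OrdLE n ∧ (S ^ n).coeff n = 1 := by
  induction n with
  | zero =>
    refine ⟨fun i hi => ?_, ?_⟩
    · change (mono (1 : R) 0).coeff i = 0
      rw [coeff_mono, if_neg (by push_cast at hi; omega)]
    · change (mono (1 : R) 0).coeff 0 = 1
      rw [coeff_mono, if_pos rfl]
  | succ n ih =>
    rw [pow_succ']
    push_cast
    exact ⟨ih.1.mul h1, by rw [ih.1.coeff_mul h1, ih.2, h2, one_mul]⟩

theorem pow_perturb {S E : PsiDO R} (h1 : S.OrdLE 1) (h2 : S.coeff 1 = 1) {e : ℤ} (he : e ≤ 0)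
    (hE : E.OrdLE e) (n : ℕ) : ∃ F : PsiDO R, (S + E) ^ n = S ^ n + F ∧ F.OrdLE (n - 1 + e) ∧
      F.coeff (n - 1 + e) = n * E.coeff e := by
  induction n with
  | zero => exact ⟨0, (add_zero _).symm, fun _ _ => rfl, by
      rw [Nat.cast_zero (R := R), zero_mul]; rfl⟩
  | succ n ih =>
    obtain ⟨F, hF1, hF2, hF3⟩ := ih
    have hSE : (S + E).OrdLE 1 := h1.add fun i hi => hE i (by omega)
    obtain ⟨hp1, hp2⟩ := pow_monic h1 h2 n
    have h5 := hp1.mul hE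
    have h6 := hp1.coeff_mul hE
    refine ⟨F * S + (F * E + S ^ n * E), ?_, ?_⟩
    · rw [pow_succ', hF1, add_mul', mul_add', mul_add', pow_succ']
      abel
    · have h7 := hF2.mul h1
      have h8 := hF2.coeff_mul h1
      have h9 := hF2.mul hE
      have e1 : ((n + 1 : ℕ) : ℤ) - 1 + e = n - 1 + e + 1 := by push_cast; ring
      have e2 : (n : ℤ) + e = n - 1 + e + 1 := by ring
      rw [e2] at h5 h6
      rw [e1]
      refine ⟨h7.add (OrdLE.add (fun i hi => h9 i (by omega)) h5), ?_⟩
      rw [coeff_add, coeff_add, h6, h8, hF3, hp2, h2, h9 _ (by omega)]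
      push_cast
      ring

theorem existsUnique_isMonicRoot {N : ℕ} (hN : IsUnit (N : R)) {L : PsiDO R}
    (hL : L.OrdLE N) (hL1 : L.coeff N = 1) : ∃! S, IsMonicRoot N L S := by
  obtain ⟨w, hw⟩ := hN.exists_right_inv
  let st : ℕ → PsiDO R → PsiDO R := fun k S =>
    S + mono (w * (L.coeff (N - 1 - k) - (S ^ N).coeff (N - 1 - k))) (-k)
  let T : ℕ → PsiDO R := fun k => Nat.rec (mono 1 1) st k
  have hT : ∀ k, T (k + 1) =
    T k + mono (w * (L.coeff (N - 1 - k) - ((T k) ^ N).coeff (N - 1 - k))) (-k) := fun _ => rfl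
  have hmono : ∀ (a : R) (i : ℤ), (mono a i).OrdLE i := fun a i j hj => if_neg (ne_of_gt hj)
  have hT1 : ∀ k, (T k).OrdLE 1 ∧ (T k).coeff 1 = 1 := by
    intro k
    induction k with
    | zero => exact ⟨hmono 1 1, by change (mono (1 : R) 1).coeff 1 = 1; rw [coeff_mono, if_pos rfl]⟩
    | succ k ih =>
      rw [hT]
      refine ⟨ih.1.add fun i hi => hmono _ _ i (by omega), ?_⟩
      rw [coeff_add, ih.2, coeff_mono, if_neg (by omega), add_zero]
  have hT2 : ∀ k : ℕ, ∀ m : ℤ, (N : ℤ) - 1 - k < m → ((T k) ^ N).coeff m = L.coeff m := by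
    intro k
    induction k with
    | zero =>
      intro m hm
      obtain ⟨p1, p2⟩ := pow_monic (hT1 0).1 (hT1 0).2 N
      rcases lt_or_ge (N : ℤ) m with h | h
      · rw [p1 m h, hL m h]
      · have : m = N := by push_cast at hm; omega
        rw [this, p2, hL1]
    | succ k ih =>
      intro m hm
      obtain ⟨F, hF1, hF2, hF3⟩ := pow_perturb (hT1 k).1 (hT1 k).2 (e := -(k : ℤ)) (by omega)
        (hmono (w * (L.coeff (N - 1 - k) - ((T k) ^ N).coeff (N - 1 - k))) (-k)) N
      rw [hT, hF1, coeff_add]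
      rcases lt_or_ge ((N : ℤ) - 1 - k) m with h | h
      · rw [ih m h, hF2 m (by omega), add_zero]
      · have hm' : m = N - 1 + -(k : ℤ) := by push_cast at hm; omega
        rw [hm', hF3, coeff_mono, if_pos rfl, ← mul_assoc, hw, one_mul, ← sub_eq_add_neg]
        ring
  have hstab : ∀ k l : ℕ, k ≤ l → ∀ m : ℤ, -(k : ℤ) < m → (T l).coeff m = (T k).coeff m := by
    intro k l hkl
    induction l, hkl using Nat.le_induction with
    | base => intros; rfl
    | succ l hl ih =>
      intro m hm
      rw [hT, coeff_add, ih m hm, coeff_mono, if_neg (by omega), add_zero]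
  let S : PsiDO R := ⟨fun m => (T (1 - m).toNat).coeff m, 1, fun i hi => (hT1 _).1 i hi⟩
  have hS : ∀ k : ℕ, ∀ m : ℤ, -(k : ℤ) < m → S.coeff m = (T k).coeff m := by
    intro k m hm
    change (T (1 - m).toNat).coeff m = _
    rcases le_total k (1 - m).toNat with h | h
    · exact hstab _ _ h m hm
    · exact (hstab _ _ h m (by omega)).symm
  have hS1 : S.OrdLE 1 := fun i hi => (hT1 _).1 i hi
  have hS2 : S.coeff 1 = 1 := by rw [hS 0 1 (by simp), (hT1 0).2]
  have hS3 : S ^ N = L := by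
    refine ext_coeff fun m => ?_
    let k : ℕ := ((N : ℤ) - m).toNat
    have hk : (N : ℤ) - 1 - k < m := by simp only [k]; omega
    obtain ⟨F, hF1, hF2, -⟩ := pow_perturb (hT1 k).1 (hT1 k).2 (e := -(k : ℤ)) (E := S - T k)
      (by omega) (fun i hi => sub_eq_zero.2 (hS k i hi)) N
    rw [add_sub_cancel] at hF1
    rw [hF1, coeff_add, hT2 k m hk, hF2 m (by omega), add_zero]
  refine ⟨S, ⟨hS1, hS2, hS3⟩, ?_⟩
  · rintro U ⟨hU1, hU2, hU3⟩
    have key : ∀ j : ℕ, (U - S).OrdLE (-(j : ℤ)) := by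
      intro j
      induction j with
      | zero =>
        intro i hi
        refine sub_eq_zero.2 ?_
        change U.coeff i = S.coeff i
        rcases lt_or_ge 1 i with h | h
        · rw [hU1 i h, hS1 i h]
        · have : i = 1 := by push_cast at hi; omega
          rw [this, hU2, hS2]
      | succ j ih =>
        intro i hi
        rcases lt_or_ge (-(j : ℤ)) i with h | h
        · exact ih i h
        · have hi' : i = -(j : ℤ) := by push_cast at hi; omega
          obtain ⟨F, hF1, hF2, hF3⟩ := pow_perturb hS1 hS2 (by omega) ih N
          rw [add_sub_cancel, hU3, hS3] at hF1
          have hF0 : F = 0 := by simpa using hF1.symm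
          rw [hF0] at hF3
          have h0 : (N : R) * (U - S).coeff (-(j : ℤ)) = 0 := hF3.symm
          rw [hi']
          exact (hN.mul_right_eq_zero).1 h0
    refine ext_coeff fun i => sub_eq_zero.1 ?_
    exact key (1 - i).toNat i (by omega)

end PsiDO

/-! ### Differential polynomials, evolution derivations, the Lax hierarchy -/

/-- The algebra of differential polynomials over `K` in the unknowns indexed by `ι`; the variable
`(i, k)` stands for the `k`-th `x`-derivative of the `i`-th unknown. -/
abbrev DiffPoly (K : Type*) [Field K] (ι : Type*) : Type _ := MvPolynomial (ι × ℕ) K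

namespace DiffPoly

variable {K : Type*} [Field K] {ι : Type*}

/-- The `i`-th unknown. -/
def unk (i : ι) : DiffPoly K ι := MvPolynomial.X (i, 0)

/-- The `K`-linear derivation `∂ = d/dx`. -/
def dx : Derivation K (DiffPoly K ι) (DiffPoly K ι) :=
  MvPolynomial.mkDerivation K fun p => MvPolynomial.X (p.1, p.2 + 1)

instance : Differential (DiffPoly K ι) := ⟨dx.restrictScalars ℤ⟩

/-- The evolution derivation of the system `(unknown i)_t = Q i`: it sends the `k`-th `x`-derivative
of the `i`-th unknown to `∂ᵏ (Q i)`. -/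
def evol (Q : ι → DiffPoly K ι) : Derivation K (DiffPoly K ι) (DiffPoly K ι) :=
  MvPolynomial.mkDerivation K fun p => (⇑(dx (K := K) (ι := ι)))^[p.2] (Q p.1)

/-- The inclusion of the differential polynomials in `u` into those in `u` and one more unknown
`φ`, which has the index `none`. -/
def incl : DiffPoly K ι →ₐ[K] DiffPoly K (Option ι) :=
  MvPolynomial.rename fun p => (some p.1, p.2)

/-- The differential polynomial `A(φ) = ∑_{j ≥ 0} Aⱼ ∂ʲ φ`, for a differential operator `A` whose
coefficients depend on `u` only. -/
def applyPhi (A : PsiDO (DiffPoly K ι)) : DiffPoly K (Option ι) :=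
  ∑ᶠ j : ℕ, incl (A.coeff j) * MvPolynomial.X (none, j)

/-- The linear extension `u_t = Q, φ_t = A(φ)` of the system `u_t = Q`. -/
def extFlow (Q : ι → DiffPoly K ι) (A : PsiDO (DiffPoly K ι)) :
    Derivation K (DiffPoly K (Option ι)) (DiffPoly K (Option ι)) :=
  evol fun i => i.elim (applyPhi A) fun i => incl (Q i)

/-- The operator has constant coefficients (it does not involve `u`). -/
def HasConstCoeffs (A : PsiDO (DiffPoly K ι)) : Prop :=
  ∀ j, ∃ c : K, A.coeff j = MvPolynomial.C c

end DiffPoly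

open DiffPoly PsiDO

variable (K : Type*) [Field K] (N : ℕ)

/-- The scalar Lax operator `L = ∂^N + ∑_{i=0}^{N-2} uᵢ ∂^{N-2-i}`. -/
def laxOp : PsiDO (DiffPoly K (Fin (N - 1))) :=
  mono 1 N + ∑ i : Fin (N - 1), mono (unk i) ((N : ℤ) - 2 - (i : ℕ))

theorem laxOp_existsUnique_root [CharZero K] (hN : 2 ≤ N) :
    ∃! S, IsMonicRoot N (laxOp K N) S := by
  have hs : ∀ j : ℤ, (laxOp K N).coeff j = (if j = N then 1 else 0) +
      ∑ i : Fin (N - 1), (mono (unk i : DiffPoly K (Fin (N - 1)))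
        ((N : ℤ) - 2 - (i : ℕ))).coeff j := by
    intro j
    rw [laxOp, coeff_add, coeff_mono]
    congr 1
    exact coeff_sum _ _ _
  have hz : ∀ j : ℤ, (N : ℤ) ≤ j → ∑ i : Fin (N - 1), (mono (unk i : DiffPoly K (Fin (N - 1)))
        ((N : ℤ) - 2 - (i : ℕ))).coeff j = 0 :=
    fun j hj => Finset.sum_eq_zero fun i _ => if_neg (by omega)
  refine existsUnique_isMonicRoot ?_ (fun j hj => ?_) ?_
  · have h0 : (N : K) ≠ 0 := Nat.cast_ne_zero.2 (by omega)
    have := (IsUnit.mk0 _ h0).map (MvPolynomial.C (R := K) (σ := Fin (N - 1) × ℕ))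
    simpa using this
  · rw [hs, hz j hj.le, if_neg hj.ne', add_zero]
  · rw [hs, hz _ le_rfl, if_pos rfl, add_zero]

open Classical in
/-- `L^{1/N}`: the unique monic first-order pseudodifferential operator whose `N`-th power is `L`
(it exists by `laxOp_existsUnique_root`; the value `0` is never taken for `N ≥ 2`). -/
def laxRoot : PsiDO (DiffPoly K (Fin (N - 1))) :=
  if h : ∃ S, IsMonicRoot N (laxOp K N) S then h.choose else 0

/-- The differential operator `P₊ = (L^{n/N})₊`. -/
def laxPlus (n : ℕ) : PsiDO (DiffPoly K (Fin (N - 1))) := (laxRoot K N ^ n).plus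

/-- The right-hand sides of the `n`-th flow `L_t = X_n(L) = [P₊, L]`: `(uᵢ)_t` is the coefficient
of `∂^{N-2-i}` in `[P₊, L]`. -/
def laxRhs (n : ℕ) : Fin (N - 1) → DiffPoly K (Fin (N - 1)) :=
  fun i => (comm (laxPlus K N n) (laxOp K N)).coeff ((N : ℤ) - 2 - (i : ℕ))

variable {K N}

/-- The linear extensions `u_t = X₂, φ_t = A₂(φ)` and `u_t = X₃, φ_t = A₃(φ)` of the second and
the third flow commute. -/
def ExtCommute (A₂ A₃ : PsiDO (DiffPoly K (Fin (N - 1)))) : Prop :=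
  ⁅extFlow (laxRhs K N 2) A₂, extFlow (laxRhs K N 3) A₃⁆ = 0

/-- The pair of extensions is decomposed: the equations for `φ` do not involve `u`. -/
def Decomposed (A₂ A₃ : PsiDO (DiffPoly K (Fin (N - 1)))) : Prop :=
  HasConstCoeffs A₂ ∧ HasConstCoeffs A₃

/-- The operator `α u₀ + γ ∂²`. -/
def opA2 (hN : 4 ≤ N) (α γ : K) : PsiDO (DiffPoly K (Fin (N - 1))) :=
  mono (MvPolynomial.C α * unk ⟨0, by omega⟩) 0 + mono (MvPolynomial.C γ) 2

/-- The operator `a ∂(u₀) + b u₁ + f u₀ ∂ + g ∂³`. -/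
def opA3 (hN : 4 ≤ N) (a b f g : K) : PsiDO (DiffPoly K (Fin (N - 1))) :=
  mono (MvPolynomial.C a * dx (unk ⟨0, by omega⟩) + MvPolynomial.C b * unk ⟨1, by omega⟩) 0 +
    mono (MvPolynomial.C f * unk ⟨0, by omega⟩) 1 + mono (MvPolynomial.C g) 3

end

/-! Evolution derivations commute with `dx`, so the two extended flows commute exactly when their
bracket kills every unknown. On `φ` the bracket is the zero curvature expression `X₂(A₃) - X₃(A₂) -
[A₂, A₃]` applied to `φ` (`commutator_extFlow_phi`). On each `uᵢ` it is the bracket of the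
unextended flows, whatever `A₂` and `A₃` are.

With the given ansatz, zero curvature involves only the components of `u₀, u₁` in the second flow
and of `u₀` in the third. These come from the first coefficients of `L^{1/N}`. The expression is a
combination of seven distinct monomials linear in the jets of `φ`, hence vanishes iff seven scalar
equations hold (`ZeroCurvature`). Solving them (`ZeroCurvature.solve`) expresses everything through
`α` and `γ`. Either `α = 0`, which kills all coefficients involving `u`, or `γ² = 1` and `γ α =
2/N`, which leaves two solutions. They are identified with `Pₙ` and `-Pₙ†` by `opA2_eq_laxPlus`,
`opA3_eq_laxPlus` and their adjoint versions. In the lemmas on curvature the coefficient of `∂³` is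
called `c`.

Conversely, the flows themselves must commute on `u` (`commutator_evol_laxRhs`). Let `W` be the
bracket of the Lax-type extensions. The Lax equations say that `Xₙ - Pₙ` commutes with the action of
`L`, and by zero curvature the bracket of `X₂ - P₂` and `X₃ - P₃` is `W`; so `W` commutes with `L`.
Since `W` kills all derivatives of `φ`, applying this to `φ` gives `∑ W(uᵢ) φ^{(N-2-i)} = 0`, and
each `W(uᵢ)` is zero. -/

noncomputable section

open DiffPoly PsiDO

/-! ### Coefficients of products, powers and adjoints of pseudodifferential operators. -/

namespace PsiDO

variable {R : Type*} [CommRing R]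

theorem coeff_neg (P : PsiDO R) (i : ℤ) : (-P).coeff i = -P.coeff i := rfl

theorem coeff_sub (P Q : PsiDO R) (i : ℤ) : (P - Q).coeff i = P.coeff i - Q.coeff i := rfl

theorem coeff_plus (P : PsiDO R) (i : ℤ) : P.plus.coeff i = if 0 ≤ i then P.coeff i else 0 := rfl

/-- The coefficients in negative positions vanish. -/
def IsDifferential (P : PsiDO R) : Prop := ∀ i < 0, P.coeff i = 0

theorem IsDifferential.eq_sum {P : PsiDO R}
    (hP : P.IsDifferential) : ∃ n : ℕ, P = ∑ j ∈ Finset.range n, mono (P.coeff j) j := by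
  obtain ⟨m, hm⟩ := P.exists_ordLE
  refine ⟨m.toNat + 1, ext_coeff fun i => ?_⟩
  rw [coeff_sum]
  simp only [coeff_mono]
  by_cases h : 0 ≤ i ∧ i ≤ m
  · rw [Finset.sum_eq_single i.toNat]
    · rw [Int.toNat_of_nonneg h.1, if_pos rfl]
    · exact fun j _ hj => if_neg (by omega)
    · intro hi
      simp at hi
      omega
  · rcases lt_or_ge i 0 with h' | h'
    · rw [hP i h', Finset.sum_eq_zero fun j _ => if_neg (by omega)]
    · rw [hm i (by omega), Finset.sum_eq_zero fun j hj => ?_]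
      split_ifs with h2
      · exact hm j (by omega)
      · rfl

variable [Differential R]

theorem coeff_mono_mul (a : R) (i : ℕ) (Q : PsiDO R) (m : ℤ) :
    (mono a i * Q).coeff m = ∑ k ∈ Finset.range (i + 1),
      (i.choose k : R) * (a * (⇑(Differential.deriv (R := R)))^[k] (Q.coeff (m - i + k))) := by
  rw [coeff_mul, finsum_eq_sum_of_support_subset
    (s := (Finset.range (i + 1)).image fun k => ((i : ℤ), k))]
  · rw [Finset.sum_image fun _ _ _ _ h => (Prod.ext_iff.1 h).2]
    refine Finset.sum_congr rfl fun k _ => ?_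
    simp [coeff_mono, Ring.choose_natCast]
  · rintro ⟨p, k⟩ hp
    simp only [Function.mem_support, coeff_mono] at hp
    by_cases hpi : p = i
    · subst hpi
      rw [Ring.choose_natCast] at hp
      have : k < i + 1 := by
        by_contra hk
        rw [Nat.choose_eq_zero_of_lt (by omega)] at hp
        simp at hp
      simpa using this
    · simp [hpi] at hp

/-- Only `p = m - j + k` can reach `∂ʲ`, and for `k ≥ n` this position exceeds the order of `P`. The
cutoff `n` is left free so that each use can take the length it needs. -/
theorem coeff_mul_mono (P : PsiDO R) (b : R) (j m : ℤ) (n : ℕ) (hP : P.OrdLE (m - j + n - 1)) :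
    (P * mono b j).coeff m = ∑ k ∈ Finset.range n, ((Ring.choose (m - j + k) k : ℤ) : R) *
      (P.coeff (m - j + k) * (⇑(Differential.deriv (R := R)))^[k] b) := by
  rw [coeff_mul, finsum_eq_sum_of_support_subset
    (s := (Finset.range n).image fun k : ℕ => (m - j + k, k))]
  · rw [Finset.sum_image fun _ _ _ _ h => (Prod.ext_iff.1 h).2]
    refine Finset.sum_congr rfl fun k _ => ?_
    have : m - (m - j + k) + k = j := by ring
    simp [coeff_mono, this]
  · rintro ⟨p, k⟩ hp
    simp only [Function.mem_support, coeff_mono] at hp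
    by_cases hpj : m - p + k = j
    · have h1 : p = m - j + k := by omega
      have : k < n := by
        by_contra hk
        rw [hP p (by omega)] at hp
        simp at hp
      simp [this, h1]
    · simp [hpj] at hp

theorem coeff_adjoint (P : PsiDO R) (m : ℤ) (n : ℕ) (hP : P.OrdLE (m + n - 1)) :
    P.adjoint.coeff m = ∑ k ∈ Finset.range n,
      ((((m + k).negOnePow : ℤ) * Ring.choose (m + k : ℤ) k : ℤ) : R) *
      (⇑(Differential.deriv (R := R)))^[k] (P.coeff (m + k)) := by
  change ∑ᶠ k : ℕ, (((m + k).negOnePow : ℤ) * Ring.choose (m + k : ℤ) k) •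
      (⇑(Differential.deriv (R := R)))^[k] (P.coeff (m + k)) = _
  rw [finsum_eq_sum_of_support_subset (s := Finset.range n)]
  · exact Finset.sum_congr rfl fun k _ => zsmul_eq_mul _ _
  · intro k hk
    by_contra hkn
    simp only [Finset.coe_range, Set.mem_Iio, not_lt] at hkn
    rw [Function.mem_support, hP _ (by omega)] at hk
    simp at hk

/-- At depth `d` below the top, a nonzero term needs `i + k ≤ d`. The square range also contains
terms with `i + k > d`, which vanish by the order of `Q`. -/
theorem OrdLE.coeff_mul_sub {P Q : PsiDO R} {a b : ℤ} (hP : P.OrdLE a) (hQ : Q.OrdLE b) (d : ℕ) :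
    (P * Q).coeff (a + b - d) = ∑ i ∈ Finset.range (d + 1), ∑ k ∈ Finset.range (d + 1),
      ((Ring.choose (a - i) k : ℤ) : R) *
      (P.coeff (a - i) * (⇑(Differential.deriv (R := R)))^[k] (Q.coeff (b - d + i + k))) := by
  rw [PsiDO.coeff_mul, finsum_eq_sum_of_support_subset
    (s := (Finset.range (d + 1) ×ˢ Finset.range (d + 1)).image
      fun q : ℕ × ℕ => (a - q.1, q.2)), Finset.sum_image, Finset.sum_product]
  · refine Finset.sum_congr rfl fun i _ => Finset.sum_congr rfl fun k _ => ?_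
    have : a + b - d - (a - i) + k = b - d + i + k := by ring
    simp only [this, zsmul_eq_mul]
  · rintro ⟨i, k⟩ _ ⟨i', k'⟩ _ h
    simpa using h
  · rintro ⟨p, k⟩ hp
    have h : ¬ (a < p ∨ b < a + b - d - p + k) := fun h => hp (mul_term_eq_zero hP hQ _ (p, k) h)
    simp only [Finset.coe_image, Set.mem_image, Finset.mem_coe, Finset.mem_product,
      Finset.mem_range, Prod.mk.injEq, Prod.exists]
    exact ⟨(a - p).toNat, k, by omega, by omega, rfl⟩

theorem OrdLE.coeff_mul_sub_one {P Q : PsiDO R} {a b : ℤ} (hP : P.OrdLE a) (hQ : Q.OrdLE b)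
    (hP0 : P.coeff a = 1) (hQ0 : Q.coeff b = 1) :
    (P * Q).coeff (a + b - 1) = P.coeff (a - 1) + Q.coeff (b - 1) := by
  have h := hP.coeff_mul_sub hQ 1
  have h1 := hQ (b + 1) (by omega)
  simp only [Finset.sum_range_succ, Finset.sum_range_zero] at h
  simpa [hP0, hQ0, h1, add_comm] using h

/-- The leading coefficients of a product of monic operators whose second coefficient vanishes. -/
theorem OrdLE.coeff_mul_of_normalized {P Q : PsiDO R} {a b : ℤ} (hP : P.OrdLE a) (hQ : Q.OrdLE b)
    (hP0 : P.coeff a = 1) (hQ0 : Q.coeff b = 1) (hP1 : P.coeff (a - 1) = 0)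
    (hQ1 : Q.coeff (b - 1) = 0) :
    (P * Q).coeff (a + b - 2) = P.coeff (a - 2) + Q.coeff (b - 2) ∧
    (P * Q).coeff (a + b - 3) = P.coeff (a - 3) + Q.coeff (b - 3) +
      (a : R) * Differential.deriv (Q.coeff (b - 2)) := by
  have h1 := hQ (b + 1) (by omega)
  have h2 := hQ (b + 2) (by omega)
  have h3 := hQ (b + 3) (by omega)
  constructor
  · have h := hP.coeff_mul_sub hQ 2
    simp only [Finset.sum_range_succ, Finset.sum_range_zero] at h
    have e1 : b - 2 + 1 = b - 1 := by ring
    have e2 : b - 2 + 1 + 1 = b := by ring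
    have e3 : b - 2 + 1 + 2 = b + 1 := by ring
    have e4 : b - 2 + 2 + 1 = b + 1 := by ring
    have e5 : b - 2 + 2 + 2 = b + 2 := by ring
    simpa [hP0, hQ0, hP1, hQ1, h1, h2, e1, e2, e3, e4, e5, add_comm] using h
  · have h := hP.coeff_mul_sub hQ 3
    simp only [Finset.sum_range_succ, Finset.sum_range_zero] at h
    have e1 : b - 3 + 1 = b - 2 := by ring
    have e2 : b - 3 + 2 = b - 1 := by ring
    have e11 : b - 2 + 1 = b - 1 := by ring
    have e12 : b - 2 + 2 = b := by ring
    have e13 : b - 2 + 3 = b + 1 := by ring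
    have e21 : b - 1 + 1 = b := by ring
    have e22 : b - 1 + 2 = b + 1 := by ring
    have e23 : b - 1 + 3 = b + 2 := by ring
    simp [hP0, hQ0, hP1, hQ1, h1, h2, h3, e1, e2, e11, e12, e13, e21, e22, e23] at h
    rw [h]
    ring

/-- The leading coefficients of the powers of `∂ + s₁ ∂⁻¹ + s₂ ∂⁻² + ⋯`. -/
theorem coeff_pow_of_normalized {S : PsiDO R} (h1 : S.OrdLE 1) (h2 : S.coeff 1 = 1)
    (h0 : S.coeff 0 = 0) (n : ℕ) :
    (S ^ n).coeff (n - 1) = 0 ∧ (S ^ n).coeff (n - 2) = n * S.coeff (-1) ∧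
    (S ^ n).coeff (n - 3) = n * S.coeff (-2) +
      n.choose 2 * Differential.deriv (S.coeff (-1)) := by
  induction n with
  | zero =>
    have hm : S ^ 0 = mono 1 0 := rfl
    simp [hm, coeff_mono]
  | succ n ih =>
    obtain ⟨p1, p2⟩ := pow_monic h1 h2 n
    obtain ⟨i1, i2, i3⟩ := ih
    have k1 := p1.coeff_mul_sub_one h1 p2 h2
    obtain ⟨k2, k3⟩ := p1.coeff_mul_of_normalized h1 p2 h2 i1 h0
    -- The new term `n s₁'` comes from `∂ⁿ` differentiating the last factor; Pascal's rule turns it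
    -- into `binom(n+1, 2) s₁'`.
    rw [pow_succ', Nat.choose_succ_succ' n 1, Nat.choose_one_right]
    push_cast
    norm_num at k2 k3
    rw [k1, k2, k3, i1, i2, i3, sub_self, h0]
    exact ⟨by ring, by ring, by ring⟩

theorem coeff_pow_sub_one {S : PsiDO R} (h1 : S.OrdLE 1) (h2 : S.coeff 1 = 1) (n : ℕ) :
    (S ^ n).coeff (n - 1) = n * S.coeff 0 := by
  induction n with
  | zero =>
    have hm : S ^ 0 = mono 1 0 := rfl
    simp [hm, coeff_mono]
  | succ n ih =>
    obtain ⟨p1, p2⟩ := pow_monic h1 h2 n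
    have k1 := p1.coeff_mul_sub_one h1 p2 h2
    rw [pow_succ', Nat.cast_succ, Nat.cast_succ, k1, ih]
    norm_num
    ring

theorem iterate_deriv_zero (k : ℕ) : (⇑(Differential.deriv (R := R)))^[k] 0 = 0 :=
  Function.iterate_fixed (map_zero _) k

theorem iterate_deriv_eq_zero {b : R} (hb : Differential.deriv b = 0) {k : ℕ} (hk : k ≠ 0) :
    (⇑(Differential.deriv (R := R)))^[k] b = 0 := by
  obtain ⟨k, rfl⟩ := Nat.exists_eq_succ_of_ne_zero hk
  rw [Function.iterate_succ_apply, hb, iterate_deriv_zero]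

theorem coeff_mul_mono_of_deriv_eq_zero (P : PsiDO R) {b : R} (hb : Differential.deriv b = 0)
    (j m : ℤ) : (P * mono b j).coeff m = P.coeff (m - j) * b := by
  obtain ⟨a, ha⟩ := exists_ordLE P
  rw [coeff_mul_mono P b j m ((a - m + j).toNat + 1) fun i hi => ha i (by push_cast at hi; omega),
    Finset.sum_eq_single 0]
  · simp
  · intro k _ hk
    rw [iterate_deriv_eq_zero hb hk, mul_zero, mul_zero]
  · simp

theorem choose_eq_zero_of_nonneg_of_lt {n : ℤ} (hn : 0 ≤ n) {k : ℕ} (hk : n < k) :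
    Ring.choose n k = 0 := by
  lift n to ℕ using hn
  rw [Ring.choose_natCast, Nat.choose_eq_zero_of_lt (by omega), Nat.cast_zero]

/-- If `p ≥ 0` and `m - p + k ≥ 0` with `m < 0`, then `k > p`, so `binom(p, k) = 0`. -/
theorem IsDifferential.mul {P Q : PsiDO R} (hP : P.IsDifferential) (hQ : Q.IsDifferential) :
    (P * Q).IsDifferential := by
  intro m hm
  refine finsum_eq_zero_of_forall_eq_zero fun ⟨p, k⟩ => ?_
  rcases lt_or_ge p 0 with h | h
  · simp [hP p h]
  rcases lt_or_ge (m - p + k) 0 with h' | h'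
  · simp [hQ _ h']
  · rw [choose_eq_zero_of_nonneg_of_lt h (by omega), zero_smul]

theorem IsDifferential.comm {P Q : PsiDO R} (hP : P.IsDifferential) (hQ : Q.IsDifferential) :
    (comm P Q).IsDifferential := fun m hm => by
  rw [PsiDO.comm, coeff_sub, hP.mul hQ m hm, hQ.mul hP m hm, sub_zero]

theorem IsDifferential.adjoint {P : PsiDO R} (hP : P.IsDifferential) :
    P.adjoint.IsDifferential := by
  intro m hm
  refine finsum_eq_zero_of_forall_eq_zero fun k => ?_
  rcases lt_or_ge (m + k) 0 with h | h
  · rw [hP _ h, iterate_deriv_zero, smul_zero]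
  · rw [choose_eq_zero_of_nonneg_of_lt h (by omega), mul_zero, zero_smul]

end PsiDO

namespace DiffPoly

theorem deriv_eq_dx {K : Type*} [Field K] {ι : Type*} :
    ⇑(Differential.deriv (R := DiffPoly K ι)) = ⇑(dx : Derivation K (DiffPoly K ι) _) := rfl

theorem dx_X {K : Type*} [Field K] {ι : Type*} (p : ι × ℕ) :
    dx (MvPolynomial.X p : DiffPoly K ι) = MvPolynomial.X (p.1, p.2 + 1) :=
  MvPolynomial.mkDerivation_X _ _ _

theorem dx_C {K : Type*} [Field K] {ι : Type*} (c : K) :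
    dx (MvPolynomial.C c : DiffPoly K ι) = 0 :=
  MvPolynomial.derivation_C _ _

theorem dx_C_mul {K : Type*} [Field K] {ι : Type*} (c : K) (f : DiffPoly K ι) :
    dx (MvPolynomial.C c * f) = MvPolynomial.C c * dx f := by
  rw [← MvPolynomial.smul_eq_C_mul, ← MvPolynomial.smul_eq_C_mul, Derivation.map_smul]

end DiffPoly

/-! ### The root of `L`, the operators `P₂` and `P₃`, and their adjoints. -/

namespace LaxHierarchy

variable {K : Type*} [Field K] {N : ℕ}

theorem coeff_laxOp (j : ℤ) : (laxOp K N).coeff j = (if j = N then 1 else 0) +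
    ∑ i : Fin (N - 1), if j = (N : ℤ) - 2 - (i : ℕ) then unk i else 0 := by
  rw [laxOp, coeff_add, coeff_mono, coeff_sum]
  rfl

theorem coeff_laxOp_self : (laxOp K N).coeff N = 1 := by
  rw [coeff_laxOp, if_pos rfl, Finset.sum_eq_zero fun i _ => if_neg (by omega), add_zero]

theorem coeff_laxOp_sub_one : (laxOp K N).coeff (N - 1) = 0 := by
  rw [coeff_laxOp, if_neg (by omega), Finset.sum_eq_zero fun i _ => if_neg (by omega), add_zero]

theorem ordLE_laxOp : (laxOp K N).OrdLE N := fun j hj => by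
  rw [coeff_laxOp, if_neg (by omega), Finset.sum_eq_zero fun i _ => if_neg (by omega), add_zero]

theorem coeff_laxOp_neg (j : ℤ) (hj : j < 0) : (laxOp K N).coeff j = 0 := by
  rw [coeff_laxOp, if_neg (by omega), Finset.sum_eq_zero fun i _ => if_neg (by omega), add_zero]

theorem coeff_laxOp_unk (i : Fin (N - 1)) (j : ℤ) (hj : j = (N : ℤ) - 2 - (i : ℕ)) :
    (laxOp K N).coeff j = unk i := by
  rw [coeff_laxOp, if_neg (by omega), Finset.sum_eq_single i, if_pos hj, zero_add]
  · exact fun k _ hk => if_neg fun h => hk (Fin.ext (by omega))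
  · simp

theorem laxRoot_spec [CharZero K] (hN : 2 ≤ N) : IsMonicRoot N (laxOp K N) (laxRoot K N) := by
  have h := (laxOp_existsUnique_root K N hN).exists
  rw [laxRoot, dif_pos h]
  exact h.choose_spec

/-- Comparison of the coefficients of `∂^{N-1}`, `∂^{N-2}`, `∂^{N-3}` in `S^N = L`. Each determines
the next coefficient of `S` after division by `N`. -/
theorem coeff_laxRoot [CharZero K] (hN : 4 ≤ N) :
    (laxRoot K N).coeff 0 = 0 ∧
    (laxRoot K N).coeff (-1) = MvPolynomial.C (1 / (N : K)) * unk ⟨0, by omega⟩ ∧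
    (laxRoot K N).coeff (-2) = MvPolynomial.C (1 / (N : K)) * unk ⟨1, by omega⟩ -
      MvPolynomial.C (((N : K) - 1) / (2 * N)) * dx (unk ⟨0, by omega⟩) := by
  obtain ⟨h1, h2, h3⟩ := laxRoot_spec (K := K) (N := N) (by omega)
  have hN0 : (N : K) ≠ 0 := Nat.cast_ne_zero.2 (by omega)
  have hC : ∀ x : DiffPoly K (Fin (N - 1)),
      MvPolynomial.C (1 / (N : K)) * ((N : DiffPoly K (Fin (N - 1))) * x) = x := by
    intro x
    rw [← map_natCast (MvPolynomial.C (R := K) (σ := Fin (N - 1) × ℕ)) N, ← mul_assoc, ← map_mul,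
      one_div, inv_mul_cancel₀ hN0, map_one, one_mul]
  have h0 : (laxRoot K N).coeff 0 = 0 := by
    have h := coeff_pow_sub_one h1 h2 N
    rw [h3, coeff_laxOp_sub_one] at h
    rw [← hC ((laxRoot K N).coeff 0), ← h, mul_zero]
  obtain ⟨-, k2, k3⟩ := coeff_pow_of_normalized h1 h2 h0 N
  rw [h3, coeff_laxOp_unk ⟨0, by omega⟩ _ (by simp)] at k2
  rw [h3, coeff_laxOp_unk ⟨1, by omega⟩ _ (by simp; ring)] at k3
  have e1 := hC ((laxRoot K N).coeff (-1))
  rw [← k2] at e1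
  have e2 := hC ((laxRoot K N).coeff (-2))
  refine ⟨h0, e1.symm, ?_⟩
  -- The constant is `binom(N, 2) / N²`: one `1/N` from solving for `s₂`, the other from `s₁ =
  -- u₀/N`.
  have e3 : (MvPolynomial.C (((N : K) - 1) / (2 * N)) : DiffPoly K (Fin (N - 1))) =
      MvPolynomial.C (1 / (N : K)) * ((N.choose 2 : DiffPoly K (Fin (N - 1))) * MvPolynomial.C (1 / (N : K))) := by
    rw [← map_natCast (MvPolynomial.C (R := K) (σ := Fin (N - 1) × ℕ)), ← map_mul, ← map_mul,
      Nat.cast_choose_two]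
    congr 1
    field_simp
  rw [← e1, deriv_eq_dx, dx_C_mul] at k3
  rw [k3, e3, mul_add, e2]
  ring

theorem ordLE_opA2 (hN : 4 ≤ N) (α γ : K) : (opA2 hN α γ).OrdLE 2 := fun i hi => by
  rw [opA2, coeff_add, coeff_mono, coeff_mono, if_neg (by omega), if_neg (by omega), add_zero]

theorem ordLE_opA3 (hN : 4 ≤ N) (a b f g : K) : (opA3 hN a b f g).OrdLE 3 := fun i hi => by
  rw [opA3, coeff_add, coeff_add, coeff_mono, coeff_mono, coeff_mono, if_neg (by omega),
    if_neg (by omega), if_neg (by omega), add_zero, add_zero]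

theorem opA2_eq_laxPlus [CharZero K] (hN : 4 ≤ N) :
    opA2 hN (2 / (N : K)) 1 = laxPlus K N 2 := by
  obtain ⟨h1, h2, h3⟩ := laxRoot_spec (K := K) (N := N) (by omega)
  obtain ⟨s0, s1, s2⟩ := coeff_laxRoot (K := K) hN
  obtain ⟨p1, p2⟩ := pow_monic h1 h2 2
  obtain ⟨k1, k2, k3⟩ := coeff_pow_of_normalized h1 h2 s0 2
  norm_num at p1 p2 k1 k2
  refine ext_coeff fun i => ?_
  rw [laxPlus, coeff_plus]
  rcases lt_or_ge 2 i with h | h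
  · rw [ordLE_opA2 hN _ _ i h, p1 i h, ite_self]
  rcases lt_or_ge i 0 with h' | h'
  · rw [if_neg (by omega), opA2, coeff_add, coeff_mono, coeff_mono, if_neg (by omega),
      if_neg (by omega), add_zero]
  rw [if_pos h']
  have e : (MvPolynomial.C (2 / (N : K)) : DiffPoly K (Fin (N - 1))) =
      2 * MvPolynomial.C (1 / (N : K)) := by
    rw [← map_ofNat (MvPolynomial.C (R := K) (σ := Fin (N - 1) × ℕ)) 2, ← map_mul]
    congr 1
    ring
  interval_cases i
  · rw [k2, s1, opA2, e]
    simp [coeff_add, coeff_mono]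
    ring
  · rw [k1]
    simp [opA2, coeff_add, coeff_mono]
  · rw [p2]
    simp [opA2, coeff_add, coeff_mono]

theorem opA3_eq_laxPlus [CharZero K] (hN : 4 ≤ N) :
    opA3 hN (3 * (3 - (N : K)) / (2 * (N : K))) (3 / (N : K)) (3 / (N : K)) 1 =
      laxPlus K N 3 := by
  obtain ⟨h1, h2, h3⟩ := laxRoot_spec (K := K) (N := N) (by omega)
  obtain ⟨s0, s1, s2⟩ := coeff_laxRoot (K := K) hN
  obtain ⟨p1, p2⟩ := pow_monic h1 h2 3
  obtain ⟨k1, k2, k3⟩ := coeff_pow_of_normalized h1 h2 s0 3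
  have hN0 : (N : K) ≠ 0 := Nat.cast_ne_zero.2 (by omega)
  norm_num [Nat.choose] at p1 p2 k1 k2 k3
  refine ext_coeff fun i => ?_
  rw [laxPlus, coeff_plus]
  rcases lt_or_ge 3 i with h | h
  · rw [ordLE_opA3 hN _ _ _ _ i h, p1 i h, ite_self]
  rcases lt_or_ge i 0 with h' | h'
  · rw [if_neg (by omega), opA3, coeff_add, coeff_add, coeff_mono, coeff_mono, coeff_mono,
      if_neg (by omega), if_neg (by omega), if_neg (by omega), add_zero, add_zero]
  rw [if_pos h']
  have e : (MvPolynomial.C (3 / (N : K)) : DiffPoly K (Fin (N - 1))) =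
      3 * MvPolynomial.C (1 / (N : K)) := by
    rw [← map_ofNat (MvPolynomial.C (R := K) (σ := Fin (N - 1) × ℕ)) 3, ← map_mul]
    congr 1
    ring
  have e' : (MvPolynomial.C (3 * (3 - (N : K)) / (2 * (N : K))) : DiffPoly K (Fin (N - 1))) =
      3 * MvPolynomial.C (1 / (N : K)) - 3 * MvPolynomial.C (((N : K) - 1) / (2 * N)) := by
    rw [← map_ofNat (MvPolynomial.C (R := K) (σ := Fin (N - 1) × ℕ)) 3, ← map_mul, ← map_mul,
      ← map_sub]
    congr 1
    field_simp
    ring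
  interval_cases i
  · rw [k3, s1, s2, deriv_eq_dx, dx_C_mul, opA3, e, e']
    simp [coeff_add, coeff_mono]
    ring
  · rw [k2, s1, opA3, e]
    simp [coeff_add, coeff_mono]
    ring
  · rw [k1]
    simp [opA3, coeff_add, coeff_mono]
  · rw [p2]
    simp [opA3, coeff_add, coeff_mono]

theorem isDifferential_opA2 (hN : 4 ≤ N) (α γ : K) : (opA2 hN α γ).IsDifferential := fun i hi => by
  rw [opA2, coeff_add, coeff_mono, coeff_mono, if_neg (by omega), if_neg (by omega), add_zero]

theorem isDifferential_opA3 (hN : 4 ≤ N) (a b f g : K) : (opA3 hN a b f g).IsDifferential :=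
  fun i hi => by
    rw [opA3, coeff_add, coeff_add, coeff_mono, coeff_mono, coeff_mono, if_neg (by omega),
      if_neg (by omega), if_neg (by omega), add_zero, add_zero]

theorem isDifferential_laxOp : (laxOp K N).IsDifferential := coeff_laxOp_neg

theorem adjoint_opA2 (hN : 4 ≤ N) (α γ : K) :
    (opA2 hN α γ).adjoint = opA2 hN α γ := by
  have hP := ordLE_opA2 hN α γ
  refine ext_coeff fun i => ?_
  rcases lt_or_ge 2 i with h | h
  · rw [hP i h, coeff_adjoint _ i 0 fun j hj => hP j (by push_cast at hj; omega),
      Finset.sum_range_zero]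
  rcases lt_or_ge i 0 with h' | h'
  · rw [isDifferential_opA2 hN α γ i h', (isDifferential_opA2 hN α γ).adjoint i h']
  rw [coeff_adjoint _ i 3 fun j hj => hP j (by push_cast at hj; omega)]
  interval_cases i <;> simp [opA2, coeff_add, coeff_mono, Finset.sum_range_succ, deriv_eq_dx]

/-- Since `(f u₀ ∂)† = -f u₀ ∂ - f ∂(u₀)`, the coefficient `a` becomes `a - f`. Pulling out the sign
shows that the ansatz is stable under `A ↦ -A†`. -/
theorem adjoint_opA3 (hN : 4 ≤ N) (a b f g : K) :
    (opA3 hN a b f g).adjoint = -opA3 hN (f - a) (-b) f g := by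
  have hP := ordLE_opA3 hN a b f g
  refine ext_coeff fun i => ?_
  rw [coeff_neg]
  rcases lt_or_ge 3 i with h | h
  · rw [ordLE_opA3 hN _ _ _ _ i h,
      coeff_adjoint _ i 0 fun j hj => hP j (by push_cast at hj; omega),
      Finset.sum_range_zero, neg_zero]
  rcases lt_or_ge i 0 with h' | h'
  · rw [isDifferential_opA3 hN _ _ _ _ i h', (isDifferential_opA3 hN a b f g).adjoint i h',
      neg_zero]
  rw [coeff_adjoint _ i 4 fun j hj => hP j (by push_cast at hj; omega)]
  interval_cases i <;>
    simp [opA3, coeff_add, coeff_mono, Finset.sum_range_succ, deriv_eq_dx] <;>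
    try ring

theorem opA2_eq_neg_adjoint [CharZero K] (hN : 4 ≤ N) :
    opA2 hN (-(2 / (N : K))) (-1) = -(laxPlus K N 2).adjoint := by
  rw [← opA2_eq_laxPlus hN, adjoint_opA2]
  refine ext_coeff fun i => ?_
  simp only [opA2, coeff_neg, coeff_add, coeff_mono]
  split_ifs <;> simp [add_comm]

theorem opA3_eq_neg_adjoint [CharZero K] (hN : 4 ≤ N) :
    opA3 hN (3 * ((N : K) - 1) / (2 * (N : K))) (-(3 / (N : K))) (3 / (N : K)) 1 =
      -(laxPlus K N 3).adjoint := by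
  have hN0 : (N : K) ≠ 0 := Nat.cast_ne_zero.2 (by omega)
  rw [← opA3_eq_laxPlus hN, adjoint_opA3, neg_neg]
  congr 1
  field_simp
  ring

/-! ### The flows: commutators with `L` and their components. -/

theorem coeff_mono_mul_of_le_three {R : Type*} [CommRing R] [Differential R] (a : R)
    (Q : PsiDO R) (m : ℤ) :
    (mono a 0 * Q).coeff m = a * Q.coeff m ∧
    (mono a 1 * Q).coeff m = a * (Q.coeff (m - 1) + Differential.deriv (Q.coeff m)) ∧
    (mono a 2 * Q).coeff m = a * (Q.coeff (m - 2) + 2 * Differential.deriv (Q.coeff (m - 1)) +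
      Differential.deriv (Differential.deriv (Q.coeff m))) ∧
    (mono a 3 * Q).coeff m = a * (Q.coeff (m - 3) + 3 * Differential.deriv (Q.coeff (m - 2)) +
      3 * Differential.deriv (Differential.deriv (Q.coeff (m - 1))) +
      Differential.deriv (Differential.deriv (Differential.deriv (Q.coeff m)))) := by
  have e1 : m - 2 + 1 = m - 1 := by ring
  have e2 : m - 3 + 1 = m - 2 := by ring
  have e3 : m - 3 + 2 = m - 1 := by ring
  refine ⟨?_, ?_, ?_, ?_⟩
  · simpa using coeff_mono_mul a 0 Q m
  · have h := coeff_mono_mul a 1 Q m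
    simp [Finset.sum_range_succ] at h
    rw [h]
    ring
  · have h := coeff_mono_mul a 2 Q m
    simp [Finset.sum_range_succ, e1] at h
    rw [h]
    ring
  · have h := coeff_mono_mul a 3 Q m
    simp [Finset.sum_range_succ, e2, e3, Nat.choose] at h
    rw [h]
    ring

theorem iterate_dx_C_mul {ι : Type*} (c : K) (f : DiffPoly K ι) (k : ℕ) :
    dx^[k] (MvPolynomial.C c * f) = MvPolynomial.C c * dx^[k] f := by
  induction k generalizing f with
  | zero => rfl
  | succ k ih => rw [Function.iterate_succ_apply, dx_C_mul, ih, ← Function.iterate_succ_apply]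

/-- Multiplication by `∂²` on the right is a mere shift, so the two `Q.coeff (m - 2)` cancel. The
remaining sum is `Q · α u₀`, cut off at the order of `Q`. -/
theorem coeff_comm_opA2 (hN : 4 ≤ N) (α : K) (Q : PsiDO (DiffPoly K (Fin (N - 1)))) (m : ℤ)
    (n : ℕ) (hQ : Q.OrdLE (m + n - 1)) :
    (comm (opA2 hN α 1) Q).coeff m = MvPolynomial.C α * unk ⟨0, by omega⟩ * Q.coeff m +
      2 * dx (Q.coeff (m - 1)) + dx (dx (Q.coeff m)) -
      ∑ k ∈ Finset.range n, ((Ring.choose (m + k) k : ℤ) : DiffPoly K (Fin (N - 1))) *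
        (Q.coeff (m + k) * MvPolynomial.C α * dx^[k] (unk ⟨0, by omega⟩)) := by
  obtain ⟨h0, -, -, -⟩ := coeff_mono_mul_of_le_three
    (MvPolynomial.C α * unk ⟨0, by omega⟩ : DiffPoly K (Fin (N - 1))) Q m
  obtain ⟨-, -, h2, -⟩ := coeff_mono_mul_of_le_three (1 : DiffPoly K (Fin (N - 1))) Q m
  have k0 := coeff_mul_mono Q (MvPolynomial.C α * unk ⟨0, by omega⟩) 0 m n
    fun j hj => hQ j (by omega)
  have k2 := coeff_mul_mono_of_deriv_eq_zero Q (b := 1) (Derivation.map_one_eq_zero _) 2 m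
  rw [PsiDO.comm, opA2, map_one, coeff_sub, add_mul', mul_add', coeff_add, coeff_add, h0, h2, k0, k2]
  simp only [deriv_eq_dx, iterate_dx_C_mul, sub_zero, mul_assoc]
  ring

theorem coeff_comm_opA3 (hN : 4 ≤ N) (a b f : K) (Q : PsiDO (DiffPoly K (Fin (N - 1)))) (m : ℤ)
    (n : ℕ) (hQ : Q.OrdLE (m + n - 1)) :
    (comm (opA3 hN a b f 1) Q).coeff m =
      (MvPolynomial.C a * dx (unk ⟨0, by omega⟩) + MvPolynomial.C b * unk ⟨1, by omega⟩) *
        Q.coeff m + MvPolynomial.C f * unk ⟨0, by omega⟩ * (Q.coeff (m - 1) + dx (Q.coeff m)) +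
      3 * dx (Q.coeff (m - 2)) + 3 * dx (dx (Q.coeff (m - 1))) + dx (dx (dx (Q.coeff m))) -
      ∑ k ∈ Finset.range n, ((Ring.choose (m + k) k : ℤ) : DiffPoly K (Fin (N - 1))) *
        (Q.coeff (m + k) * (MvPolynomial.C a * dx^[k + 1] (unk ⟨0, by omega⟩) +
          MvPolynomial.C b * dx^[k] (unk ⟨1, by omega⟩))) -
      ∑ k ∈ Finset.range (n + 1), ((Ring.choose (m - 1 + k) k : ℤ) : DiffPoly K (Fin (N - 1))) *
        (Q.coeff (m - 1 + k) * (MvPolynomial.C f * dx^[k] (unk ⟨0, by omega⟩))) := by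
  obtain ⟨h0, -, -, -⟩ := coeff_mono_mul_of_le_three
    (MvPolynomial.C a * dx (unk ⟨0, by omega⟩) + MvPolynomial.C b * unk ⟨1, by omega⟩ :
      DiffPoly K (Fin (N - 1))) Q m
  obtain ⟨-, h1, -, -⟩ := coeff_mono_mul_of_le_three
    (MvPolynomial.C f * unk ⟨0, by omega⟩ : DiffPoly K (Fin (N - 1))) Q m
  obtain ⟨-, -, -, h3⟩ := coeff_mono_mul_of_le_three (1 : DiffPoly K (Fin (N - 1))) Q m
  have k0 := coeff_mul_mono Q (MvPolynomial.C a * dx (unk ⟨0, by omega⟩) +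
    MvPolynomial.C b * unk ⟨1, by omega⟩) 0 m n fun j hj => hQ j (by omega)
  have k1 := coeff_mul_mono Q (MvPolynomial.C f * unk ⟨0, by omega⟩) 1 m (n + 1)
    fun j hj => hQ j (by push_cast at hj; omega)
  have k3 := coeff_mul_mono_of_deriv_eq_zero Q (b := 1) (Derivation.map_one_eq_zero _) 3 m
  rw [PsiDO.comm, opA3, map_one, coeff_sub, add_mul', mul_add', add_mul', mul_add', coeff_add, coeff_add,
    coeff_add, coeff_add, h0, h1, h3, k0, k1, k3]
  simp only [iterate_deriv_add]
  simp only [deriv_eq_dx, iterate_dx_C_mul, sub_zero, Function.iterate_succ_apply]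
  ring

theorem C_ring_choose_two [CharZero K] {ι : Type*} :
    ((Ring.choose (N : ℤ) 2 : ℤ) : DiffPoly K ι) = MvPolynomial.C ((N : K) * (N - 1) / 2) := by
  rw [Ring.choose_natCast, Int.cast_natCast, ← Nat.cast_choose_two, map_natCast]

theorem C_ring_choose_three [CharZero K] {ι : Type*} :
    ((Ring.choose (N : ℤ) 3 : ℤ) : DiffPoly K ι) =
      MvPolynomial.C ((N : K) * (N - 1) * (N - 2) / 6) := by
  rw [Ring.choose_natCast, Int.cast_natCast, ← map_natCast (MvPolynomial.C (R := K))]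
  congr 1
  have h : ∀ n : ℕ, (n.choose 3 : K) = (n : K) * (n - 1) * (n - 2) / 6 := by
    intro n
    induction n with
    | zero => simp
    | succ n ih =>
      rw [Nat.choose_succ_succ' n 2, Nat.cast_add, ih, Nat.cast_choose_two]
      push_cast
      ring
  exact h N

theorem C_natCast {ι : Type*} : (N : DiffPoly K ι) = MvPolynomial.C (N : K) :=
  (map_natCast _ _).symm

/-- The first components of the second flow. -/
theorem laxRhs_two [CharZero K] (hN : 4 ≤ N) :
    laxRhs K N 2 ⟨0, by omega⟩ = 2 * dx (unk ⟨1, by omega⟩) +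
      MvPolynomial.C (2 - (N : K)) * dx (dx (unk ⟨0, by omega⟩)) ∧
    laxRhs K N 2 ⟨1, by omega⟩ = 2 * dx (unk ⟨2, by omega⟩) + dx (dx (unk ⟨1, by omega⟩)) -
      MvPolynomial.C (((N : K) - 1) * (N - 2) / 3) * dx (dx (dx (unk ⟨0, by omega⟩))) -
      MvPolynomial.C (2 / (N : K) * (N - 2)) *
        (unk ⟨0, by omega⟩ * dx (unk ⟨0, by omega⟩)) := by
  have hN0 : (N : K) ≠ 0 := Nat.cast_ne_zero.2 (by omega)
  have l0 := coeff_laxOp_self (K := K) (N := N)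
  have l1 := coeff_laxOp_sub_one (K := K) (N := N)
  have l2 := coeff_laxOp_unk (K := K) (N := N) ⟨0, by omega⟩ (N - 2) (by simp)
  have l3 := coeff_laxOp_unk (K := K) (N := N) ⟨1, by omega⟩ (N - 3) (by simp; ring)
  have l4 := coeff_laxOp_unk (K := K) (N := N) ⟨2, by omega⟩ (N - 4) (by simp; ring)
  have e1 : (N : ℤ) - 2 + 1 = N - 1 := by ring
  have e2 : (N : ℤ) - 3 + 1 = N - 2 := by ring
  have e3 : (N : ℤ) - 3 + 2 = N - 1 := by ring
  have e4 : (N : ℤ) - 2 - 1 = N - 3 := by ring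
  have e5 : (N : ℤ) - 3 - 1 = N - 4 := by ring
  constructor
  · have h := coeff_comm_opA2 hN (2 / (N : K)) (laxOp K N) (N - 2) 3
      fun j hj => ordLE_laxOp j (by push_cast at hj; omega)
    simp [Finset.sum_range_succ, e1, e4, l0, l1, l2, l3, C_ring_choose_two] at h
    -- In the coefficient of `u₀''`, the `1` comes from `∂² L` and the subtracted term from `∂^N`
    -- acting on `(2/N) u₀`.
    have c : (MvPolynomial.C (2 - (N : K)) : DiffPoly K (Fin (N - 1))) =
        1 - MvPolynomial.C ((N : K) * (N - 1) / 2) * MvPolynomial.C (2 / (N : K)) := by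
      rw [← map_one MvPolynomial.C, ← map_mul, ← map_sub]
      congr 1
      field_simp
      ring
    rw [laxRhs, ← opA2_eq_laxPlus hN, c]
    simp [h]
    ring
  · have h := coeff_comm_opA2 hN (2 / (N : K)) (laxOp K N) (N - 3) 4
      fun j hj => ordLE_laxOp j (by push_cast at hj; omega)
    simp [Finset.sum_range_succ, e2, e3, e5, l0, l1, l2, l3, l4, C_ring_choose_three] at h
    have c : (MvPolynomial.C (((N : K) - 1) * (N - 2) / 3) : DiffPoly K (Fin (N - 1))) =
        MvPolynomial.C ((N : K) * (N - 1) * (N - 2) / 6) * MvPolynomial.C (2 / (N : K)) := by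
      rw [← map_mul]
      congr 1
      field_simp
      ring
    have c' : (MvPolynomial.C (2 / (N : K) * (N - 2)) : DiffPoly K (Fin (N - 1))) =
        MvPolynomial.C (2 / (N : K)) * ((N : DiffPoly K (Fin (N - 1))) - 2) := by
      rw [map_mul, map_sub, C_natCast, map_ofNat]
    have e : (N : ℤ) - 2 - 1 = N - 3 := by ring
    rw [laxRhs, ← opA2_eq_laxPlus hN, c, c']
    simp [h, e]
    ring

/-- The first component of the third flow. -/
theorem laxRhs_three [CharZero K] (hN : 4 ≤ N) :
    laxRhs K N 3 ⟨0, by omega⟩ = 3 * dx (unk ⟨2, by omega⟩) +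
      MvPolynomial.C (3 - 3 * ((N : K) - 1) / 2) * dx (dx (unk ⟨1, by omega⟩)) +
      MvPolynomial.C (1 - ((N : K) - 1) * (N - 2) / 2 - 3 * ((N : K) - 1) * (3 - N) / 4) *
        dx (dx (dx (unk ⟨0, by omega⟩))) +
      MvPolynomial.C (3 / (N : K) * (3 - N)) *
        (unk ⟨0, by omega⟩ * dx (unk ⟨0, by omega⟩)) := by
  have hN0 : (N : K) ≠ 0 := Nat.cast_ne_zero.2 (by omega)
  have l0 := coeff_laxOp_self (K := K) (N := N)
  have l1 := coeff_laxOp_sub_one (K := K) (N := N)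
  have l2 := coeff_laxOp_unk (K := K) (N := N) ⟨0, by omega⟩ (N - 2) (by simp)
  have l3 := coeff_laxOp_unk (K := K) (N := N) ⟨1, by omega⟩ (N - 3) (by simp; ring)
  have l4 := coeff_laxOp_unk (K := K) (N := N) ⟨2, by omega⟩ (N - 4) (by simp; ring)
  have e1 : (N : ℤ) - 2 + 1 = N - 1 := by ring
  have e2 : (N : ℤ) - 3 + 1 = N - 2 := by ring
  have e3 : (N : ℤ) - 3 + 2 = N - 1 := by ring
  have e4 : (N : ℤ) - 2 - 1 = N - 3 := by ring
  have e5 : (N : ℤ) - 2 - 2 = N - 4 := by ring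
  have h := coeff_comm_opA3 hN (3 * (3 - (N : K)) / (2 * (N : K))) (3 / (N : K)) (3 / (N : K))
      (laxOp K N) (N - 2) 3 fun j hj => ordLE_laxOp j (by push_cast at hj; omega)
  simp only [Finset.sum_range_succ, Finset.sum_range_zero, Nat.cast_zero, Nat.cast_one,
    Nat.cast_ofNat, add_zero, sub_add_cancel, e1, e2, e3, e4, e5, l0, l1, l2, l3, l4,
    C_ring_choose_two, C_ring_choose_three, Ring.choose_zero_right, Ring.choose_one_right,
    Function.iterate_succ_apply, Function.iterate_zero_apply] at h
  have c1 : (MvPolynomial.C (3 - 3 * ((N : K) - 1) / 2) : DiffPoly K (Fin (N - 1))) =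
      3 - MvPolynomial.C ((N : K) * (N - 1) / 2) * MvPolynomial.C (3 / (N : K)) := by
    rw [← map_ofNat (MvPolynomial.C (R := K)) 3, ← map_mul, ← map_sub]
    congr 1
    field_simp
  have c2 : (MvPolynomial.C (1 - ((N : K) - 1) * (N - 2) / 2 -
      3 * ((N : K) - 1) * (3 - N) / 4) : DiffPoly K (Fin (N - 1))) =
      1 - MvPolynomial.C ((N : K) * (N - 1) * (N - 2) / 6) * MvPolynomial.C (3 / (N : K)) -
        MvPolynomial.C ((N : K) * (N - 1) / 2) *
          MvPolynomial.C (3 * (3 - (N : K)) / (2 * (N : K))) := by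
    rw [← map_one MvPolynomial.C, ← map_mul, ← map_mul, ← map_sub, ← map_sub]
    congr 1
    field_simp
    ring
  have c3 : (MvPolynomial.C (3 / (N : K) * (3 - N)) : DiffPoly K (Fin (N - 1))) =
      MvPolynomial.C (3 / (N : K)) * (3 - (N : DiffPoly K (Fin (N - 1)))) := by
    rw [map_mul, map_sub, C_natCast, map_ofNat]
  rw [laxRhs, ← opA3_eq_laxPlus hN, Nat.cast_zero, sub_zero, h, c1, c2, c3]
  push_cast
  ring

theorem eq_sum_mono_of_coeff {R : Type*} [CommRing R] (P : PsiDO R) (hP : P.IsDifferential)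
    (hN : 2 ≤ N) (hP' : ∀ m : ℤ, N - 1 ≤ m → P.coeff m = 0) :
    P = ∑ i : Fin (N - 1), mono (P.coeff ((N : ℤ) - 2 - (i : ℕ))) ((N : ℤ) - 2 - (i : ℕ)) := by
  refine ext_coeff fun m => ?_
  rw [coeff_sum]
  simp only [coeff_mono]
  by_cases h : 0 ≤ m ∧ m ≤ N - 2
  · rw [Finset.sum_eq_single ⟨(N - 2 - m).toNat, by omega⟩]
    · have : (N : ℤ) - 2 - ((N - 2 - m).toNat : ℕ) = m := by omega
      simp only [this, if_true]
    · intro i _ hi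
      exact if_neg fun hm => hi (Fin.ext (by simp; omega))
    · simp
  · rw [Finset.sum_eq_zero fun i _ => if_neg (by omega)]
    rcases lt_or_ge m 0 with h' | h'
    · exact hP m h'
    · exact hP' m (by omega)

theorem dx_coeff_laxOp (m : ℤ) (hm : N - 1 ≤ m) : dx ((laxOp K N).coeff m) = 0 := by
  rcases lt_or_ge (N : ℤ) m with h | h
  · rw [ordLE_laxOp m h, map_zero]
  obtain rfl | rfl : m = N - 1 ∨ m = N := by omega
  · rw [coeff_laxOp_sub_one, map_zero]
  · rw [coeff_laxOp_self]
    exact Derivation.map_one_eq_zero _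

/-- `laxRhs` records only the positions `0, …, N - 2`. The content is that `[P₂, L]` has nothing
outside them, so the Lax equation is an identity of operators. -/
theorem comm_laxPlus_two [CharZero K] (hN : 4 ≤ N) : comm (laxPlus K N 2) (laxOp K N) =
    ∑ i : Fin (N - 1), mono (laxRhs K N 2 i) ((N : ℤ) - 2 - (i : ℕ)) := by
  have hN0 : (N : K) ≠ 0 := Nat.cast_ne_zero.2 (by omega)
  refine eq_sum_mono_of_coeff _ ?_ (by omega) fun m hm => ?_
  · rw [← opA2_eq_laxPlus hN]
    exact (isDifferential_opA2 hN _ _).comm isDifferential_laxOp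
  rw [← opA2_eq_laxPlus hN]
  rcases lt_or_ge (N - 1 : ℤ) m with h | h
  · rw [coeff_comm_opA2 hN _ _ m 1 fun j hj => ordLE_laxOp j (by push_cast at hj; omega),
      dx_coeff_laxOp m hm, dx_coeff_laxOp (m - 1) (by omega)]
    simp
    ring
  -- At `∂^{N-1}` the term `2 u₀'` of `∂² L` cancels `N · (2/N) u₀'` of `L P₂`.
  · obtain rfl : m = N - 1 := by omega
    rw [coeff_comm_opA2 hN _ _ _ 2 fun j hj => ordLE_laxOp j (by push_cast at hj; omega)]
    have l2 := coeff_laxOp_unk (K := K) (N := N) ⟨0, by omega⟩ (N - 2) (by simp)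
    have e : (N : ℤ) - 1 - 1 = N - 2 := by ring
    have c : (N : DiffPoly K (Fin (N - 1))) * MvPolynomial.C (2 / (N : K)) = 2 := by
      rw [C_natCast, ← map_mul, mul_div_cancel₀ _ hN0, map_ofNat]
    simp [Finset.sum_range_succ, coeff_laxOp_sub_one, coeff_laxOp_self, e, l2]
    rw [← mul_assoc, c]
    ring

theorem comm_laxPlus_three [CharZero K] (hN : 4 ≤ N) : comm (laxPlus K N 3) (laxOp K N) =
    ∑ i : Fin (N - 1), mono (laxRhs K N 3 i) ((N : ℤ) - 2 - (i : ℕ)) := by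
  have hN0 : (N : K) ≠ 0 := Nat.cast_ne_zero.2 (by omega)
  have c : (N : DiffPoly K (Fin (N - 1))) * MvPolynomial.C (3 / (N : K)) = 3 := by
    rw [C_natCast, ← map_mul, mul_div_cancel₀ _ hN0, map_ofNat]
  have l2 := coeff_laxOp_unk (K := K) (N := N) ⟨0, by omega⟩ (N - 2) (by simp)
  have l3 := coeff_laxOp_unk (K := K) (N := N) ⟨1, by omega⟩ (N - 3) (by simp; ring)
  refine eq_sum_mono_of_coeff _ ?_ (by omega) fun m hm => ?_
  · rw [← opA3_eq_laxPlus hN]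
    exact (isDifferential_opA3 hN _ _ _ _).comm isDifferential_laxOp
  rw [← opA3_eq_laxPlus hN]
  rcases lt_or_ge (N : ℤ) m with h | h
  · rw [coeff_comm_opA3 hN _ _ _ _ m 0 fun j hj => ordLE_laxOp j (by push_cast at hj; omega),
      dx_coeff_laxOp m hm, dx_coeff_laxOp (m - 1) (by omega),
      dx_coeff_laxOp (m - 2) (by omega), ordLE_laxOp m h]
    simp
    ring
  obtain rfl | rfl : m = N ∨ m = N - 1 := by omega
  · rw [coeff_comm_opA3 hN _ _ _ _ _ 1 fun j hj => ordLE_laxOp j (by push_cast at hj; omega),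
      dx_coeff_laxOp _ hm, dx_coeff_laxOp ((N : ℤ) - 1) (by omega)]
    simp [Finset.sum_range_succ, coeff_laxOp_sub_one, coeff_laxOp_self, l2]
    linear_combination (-dx (unk ⟨0, by omega⟩)) * c
  · rw [coeff_comm_opA3 hN _ _ _ _ _ 2 fun j hj => ordLE_laxOp j (by push_cast at hj; omega)]
    have e1 : (N : ℤ) - 1 - 1 = N - 2 := by ring
    have e2 : (N : ℤ) - 1 - 2 = N - 3 := by ring
    have e3 : (N : ℤ) - 2 + 1 = N - 1 := by ring
    have e4 : (N : ℤ) - 2 + 2 = N := by ring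
    -- This makes the `u₀''` terms at `∂^{N-1}` cancel: the `3` comes from `∂³ L`, the left side
    -- from `∂^N` acting on the coefficients of `∂` and `∂⁰` in `P₃`.
    have c' : MvPolynomial.C ((N : K) * (N - 1) / 2) * MvPolynomial.C (3 / (N : K)) +
        (N : DiffPoly K (Fin (N - 1))) * MvPolynomial.C (3 * (3 - (N : K)) / (2 * (N : K))) =
        3 := by
      rw [C_natCast, ← map_mul, ← map_mul, ← map_add, ← map_ofNat MvPolynomial.C]
      congr 1
      field_simp
      ring
    simp only [Finset.sum_range_succ, Finset.sum_range_zero, Nat.cast_zero, Nat.cast_one,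
      Nat.cast_ofNat, add_zero, zero_add, sub_add_cancel, e1, e2, e3, e4, coeff_laxOp_self,
      coeff_laxOp_sub_one, l2, l3, C_ring_choose_two, Ring.choose_zero_right,
      Ring.choose_one_right, Function.iterate_succ_apply, Function.iterate_zero_apply, map_zero]
    push_cast
    linear_combination (-dx (unk ⟨1, by omega⟩)) * c - dx (dx (unk ⟨0, by omega⟩)) * c'

end LaxHierarchy

/-! ### Evolution derivations, linear extensions, and operators acting on the extended algebra. -/

namespace DiffPoly

variable {K : Type*} [Field K] {ι : Type*}

theorem evol_X (Q : ι → DiffPoly K ι) (p : ι × ℕ) :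
    evol Q (MvPolynomial.X p) = dx^[p.2] (Q p.1) := MvPolynomial.mkDerivation_X _ _ _

theorem evol_unk (Q : ι → DiffPoly K ι) (i : ι) : evol Q (unk i) = Q i := evol_X Q (i, 0)

theorem iterate_dx_unk (i : ι) (k : ℕ) :
    dx^[k] (unk i : DiffPoly K ι) = MvPolynomial.X (i, k) := by
  induction k with
  | zero => rfl
  | succ k ih => rw [Function.iterate_succ_apply', ih, dx_X]

theorem evol_dx (Q : ι → DiffPoly K ι) (f : DiffPoly K ι) : evol Q (dx f) = dx (evol Q f) := by
  have h : ⁅evol Q, (dx : Derivation K (DiffPoly K ι) _)⁆ = 0 := by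
    refine MvPolynomial.derivation_ext fun p => ?_
    rw [Derivation.commutator_apply, dx_X, evol_X, evol_X, Function.iterate_succ_apply', sub_self]
    rfl
  have h' := congrArg (fun D => D f) h
  simp only [Derivation.commutator_apply, Derivation.zero_apply] at h'
  exact sub_eq_zero.1 h'

theorem commutator_evol_dx (Q Q' : ι → DiffPoly K ι) (f : DiffPoly K ι) :
    ⁅evol Q, evol Q'⁆ (dx f) = dx (⁅evol Q, evol Q'⁆ f) := by
  simp only [Derivation.commutator_apply, evol_dx, map_sub]

theorem commutator_evol_iterate_dx (Q Q' : ι → DiffPoly K ι) (k : ℕ) (f : DiffPoly K ι) :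
    ⁅evol Q, evol Q'⁆ (dx^[k] f) = dx^[k] (⁅evol Q, evol Q'⁆ f) :=
  Function.Semiconj.iterate_right (f := ⇑⁅evol Q, evol Q'⁆) (commutator_evol_dx Q Q') k f

/-- The bracket of two evolution derivations commutes with `dx`, so its values on the unknowns
determine it on all jets. -/
theorem commutator_evol_eq_zero_iff (Q Q' : ι → DiffPoly K ι) :
    ⁅evol Q, evol Q'⁆ = 0 ↔ ∀ i, ⁅evol Q, evol Q'⁆ (unk i) = 0 := by
  refine ⟨fun h i => by rw [h, Derivation.zero_apply], fun h => ?_⟩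
  refine MvPolynomial.derivation_ext fun p => ?_
  rw [← iterate_dx_unk, commutator_evol_iterate_dx, h, Function.iterate_fixed (map_zero _),
    Derivation.zero_apply]

theorem incl_X (p : ι × ℕ) :
    incl (MvPolynomial.X p : DiffPoly K ι) = MvPolynomial.X (some p.1, p.2) :=
  MvPolynomial.rename_X _ _

theorem incl_C (c : K) : incl (MvPolynomial.C c : DiffPoly K ι) = MvPolynomial.C c :=
  MvPolynomial.rename_C _ _

theorem incl_unk (i : ι) : incl (unk i : DiffPoly K ι) = unk (some i) := incl_X _

/-- A derivation of the large algebra that prolongs a derivation on the unknowns prolongs it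
everywhere. -/
theorem derivation_incl {D : Derivation K (DiffPoly K ι) (DiffPoly K ι)}
    {D' : Derivation K (DiffPoly K (Option ι)) (DiffPoly K (Option ι))}
    (h : ∀ p, D' (incl (MvPolynomial.X p)) = incl (D (MvPolynomial.X p))) (f : DiffPoly K ι) :
    D' (incl f) = incl (D f) := by
  induction f using MvPolynomial.induction_on with
  | C c => rw [incl_C, MvPolynomial.derivation_C, MvPolynomial.derivation_C, map_zero]
  | add f g hf hg => simp only [map_add, hf, hg]
  | mul_X f p hf => simp only [map_mul, Derivation.leibniz, smul_eq_mul, map_add, hf, h]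

theorem dx_incl (f : DiffPoly K ι) : dx (incl f) = incl (dx f) :=
  derivation_incl (fun p => by rw [incl_X, dx_X, dx_X, incl_X]) f

theorem iterate_dx_incl (k : ℕ) (f : DiffPoly K ι) : dx^[k] (incl f) = incl (dx^[k] f) :=
  (Function.Semiconj.iterate_right (f := incl) (fun f => (dx_incl f).symm) k f).symm

theorem extFlow_incl (Q : ι → DiffPoly K ι) (A : PsiDO (DiffPoly K ι)) (f : DiffPoly K ι) :
    extFlow Q A (incl f) = incl (evol Q f) :=
  derivation_incl (fun p => by rw [incl_X, extFlow, evol_X, evol_X, ← iterate_dx_incl]; rfl) f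

theorem extFlow_phi (Q : ι → DiffPoly K ι) (A : PsiDO (DiffPoly K ι)) :
    extFlow Q A (unk none) = applyPhi A := evol_unk _ _

theorem extFlow_dx (Q : ι → DiffPoly K ι) (A : PsiDO (DiffPoly K ι)) (f : DiffPoly K (Option ι)) :
    extFlow Q A (dx f) = dx (extFlow Q A f) := evol_dx _ f

theorem iterate_dx_mul (n : ℕ) (f g : DiffPoly K ι) : dx^[n] (f * g) =
    ∑ k ∈ Finset.range (n + 1), (n.choose k : DiffPoly K ι) * (dx^[k] f * dx^[n - k] g) := by
  have h : dx^[n] (f * g) = ∑ p ∈ Finset.HasAntidiagonal.antidiagonal n,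
      (n.choose p.1 : DiffPoly K ι) * (dx^[p.1] f * dx^[p.2] g) := by
    induction n with
    | zero => simp
    | succ n ih =>
      rw [Finset.sum_antidiagonal_choose_succ_mul fun i j => dx^[i] f * dx^[j] g,
        Function.iterate_succ_apply', ih, map_sum, ← Finset.sum_add_distrib]
      refine Finset.sum_congr rfl fun ⟨i, j⟩ hij => ?_
      rw [← n.choose_symm_of_eq_add (Finset.HasAntidiagonal.mem_antidiagonal.1 hij).symm]
      simp only [Function.iterate_succ_apply', Derivation.leibniz, smul_eq_mul,
        Derivation.map_natCast]
      ring
  rw [h]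
  exact Finset.Nat.sum_antidiagonal_eq_sum_range_succ
    (fun i j => (n.choose i : DiffPoly K ι) * (dx^[i] f * dx^[j] g)) n

/-- The action of the differential part of an operator on the large algebra. -/
def act (P : PsiDO (DiffPoly K ι)) (g : DiffPoly K (Option ι)) : DiffPoly K (Option ι) :=
  ∑ᶠ j : ℕ, incl (P.coeff j) * dx^[j] g

/-- `act` allows arbitrary arguments in place of `φ`, so that operators can be composed. -/
theorem applyPhi_eq_act (P : PsiDO (DiffPoly K ι)) : applyPhi P = act P (unk none) :=
  finsum_congr fun j => by rw [iterate_dx_unk]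

theorem act_support_finite (P : PsiDO (DiffPoly K ι)) (g : DiffPoly K (Option ι)) :
    (Function.support fun j : ℕ => incl (P.coeff j) * dx^[j] g).Finite := by
  obtain ⟨m, hm⟩ := P.exists_ordLE
  refine (Set.finite_Iic m.toNat).subset fun j hj => ?_
  by_contra h
  simp only [Set.mem_Iic] at h
  exact hj (by simp only [hm j (by omega), map_zero, zero_mul])

theorem act_add_left (P Q : PsiDO (DiffPoly K ι)) (g : DiffPoly K (Option ι)) :
    act (P + Q) g = act P g + act Q g := by
  rw [act, act, act, ← finsum_add_distrib (act_support_finite P g) (act_support_finite Q g)]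
  simp only [coeff_add, map_add, add_mul]

/-- `act` as an additive map in the operator. -/
def actHom (g : DiffPoly K (Option ι)) : PsiDO (DiffPoly K ι) →+ DiffPoly K (Option ι) :=
  AddMonoidHom.mk' (fun P => act P g) fun P Q => act_add_left P Q g

theorem act_sub_left (P Q : PsiDO (DiffPoly K ι)) (g : DiffPoly K (Option ι)) :
    act (P - Q) g = act P g - act Q g := map_sub (actHom g) P Q

theorem act_sum {κ : Type*} (s : Finset κ) (P : κ → PsiDO (DiffPoly K ι))
    (g : DiffPoly K (Option ι)) : act (∑ i ∈ s, P i) g = ∑ i ∈ s, act (P i) g :=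
  map_sum (actHom g) P s

theorem act_add_right (P : PsiDO (DiffPoly K ι)) (g h : DiffPoly K (Option ι)) :
    act P (g + h) = act P g + act P h := by
  rw [act, act, act, ← finsum_add_distrib (act_support_finite P g) (act_support_finite P h)]
  exact finsum_congr fun j => by rw [← deriv_eq_dx, iterate_deriv_add, mul_add]

theorem act_mono (a : DiffPoly K ι) (j : ℕ) (g : DiffPoly K (Option ι)) :
    act (mono a j) g = incl a * dx^[j] g := by
  rw [act, finsum_eq_single _ j]
  · rw [coeff_mono, if_pos rfl]
  · intro k hk
    rw [coeff_mono, if_neg (by exact_mod_cast hk), map_zero, zero_mul]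

theorem mono_mul_mono (a b : DiffPoly K ι) (i j : ℕ) : mono a (i : ℤ) * mono b (j : ℤ) =
    ∑ k ∈ Finset.range (i + 1),
      mono ((i.choose k : DiffPoly K ι) * (a * dx^[k] b)) ((i - k + j : ℕ) : ℤ) := by
  refine ext_coeff fun m => ?_
  rw [coeff_mono_mul, coeff_sum]
  refine Finset.sum_congr rfl fun k hk => ?_
  have hk := Finset.mem_range.1 hk
  rw [coeff_mono, coeff_mono]
  by_cases h : m - i + k = j
  · rw [if_pos h, if_pos (by omega), deriv_eq_dx]
  · rw [if_neg h, if_neg (by omega), iterate_deriv_zero, mul_zero, mul_zero]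

theorem act_mono_mul_mono (a b : DiffPoly K ι) (i j : ℕ) (g : DiffPoly K (Option ι)) :
    act (mono a (i : ℤ) * mono b (j : ℤ)) g = act (mono a i) (act (mono b j) g) := by
  rw [mono_mul_mono, act_sum, act_mono, act_mono, iterate_dx_mul, Finset.mul_sum]
  refine Finset.sum_congr rfl fun k _ => ?_
  rw [act_mono, Function.iterate_add_apply, iterate_dx_incl]
  simp only [map_mul, map_natCast]
  ring

/-- On monomials this is the Leibniz rule. Differential operators are essential: `act` ignores
negative positions, so `∂⁻¹` acts as zero although `∂⁻¹ ∂ = 1`. -/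
theorem act_mul {P Q : PsiDO (DiffPoly K ι)} (hP : P.IsDifferential) (hQ : Q.IsDifferential)
    (g : DiffPoly K (Option ι)) : act (P * Q) g = act P (act Q g) := by
  have key : ∀ (s t : Finset ℕ) (x y : ℕ → DiffPoly K ι),
      act ((∑ i ∈ s, mono (x i) (i : ℤ)) * ∑ j ∈ t, mono (y j) (j : ℤ)) g =
        act (∑ i ∈ s, mono (x i) (i : ℤ)) (act (∑ j ∈ t, mono (y j) (j : ℤ)) g) := by
    intro s t x y
    let mulRight (Q : PsiDO (DiffPoly K ι)) : PsiDO (DiffPoly K ι) →+ PsiDO (DiffPoly K ι) :=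
      AddMonoidHom.mk' (fun P => P * Q) fun P P' => add_mul' P P' Q
    let mulLeft (P : PsiDO (DiffPoly K ι)) : PsiDO (DiffPoly K ι) →+ PsiDO (DiffPoly K ι) :=
      AddMonoidHom.mk' (fun Q => P * Q) fun Q Q' => mul_add' P Q Q'
    let actRight (P : PsiDO (DiffPoly K ι)) : DiffPoly K (Option ι) →+ DiffPoly K (Option ι) :=
      AddMonoidHom.mk' (act P) (act_add_right P)
    have h1 : ∀ Q : PsiDO (DiffPoly K ι), (∑ i ∈ s, mono (x i) (i : ℤ)) * Q =
        ∑ i ∈ s, mono (x i) (i : ℤ) * Q := fun Q => map_sum (mulRight Q) _ _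
    have h2 : ∀ P : PsiDO (DiffPoly K ι), P * (∑ j ∈ t, mono (y j) (j : ℤ)) =
        ∑ j ∈ t, P * mono (y j) (j : ℤ) := fun P => map_sum (mulLeft P) _ _
    have h3 : ∀ P : PsiDO (DiffPoly K ι), act P (∑ j ∈ t, act (mono (y j) (j : ℤ)) g) =
        ∑ j ∈ t, act P (act (mono (y j) (j : ℤ)) g) := fun P => map_sum (actRight P) _ _
    rw [h1, act_sum, act_sum, act_sum]
    refine Finset.sum_congr rfl fun i _ => ?_
    rw [h2, act_sum, h3]
    exact Finset.sum_congr rfl fun j _ => act_mono_mul_mono _ _ _ _ _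
  obtain ⟨m, hm⟩ := hP.eq_sum
  obtain ⟨n, hn⟩ := hQ.eq_sum
  rw [hm, hn]
  exact key _ _ _ _

end DiffPoly

/-! ### The extended flows acting on `A₂ g`, `A₃ g` and `L g`. -/

namespace LaxHierarchy

variable {K : Type*} [Field K] {N : ℕ}

theorem act_opA2 (hN : 4 ≤ N) (α γ : K) (g : DiffPoly K (Option (Fin (N - 1)))) :
    act (opA2 hN α γ) g = MvPolynomial.C α * unk (some ⟨0, by omega⟩) * g +
      MvPolynomial.C γ * dx (dx g) := by
  have h0 := act_mono (MvPolynomial.C α * unk ⟨0, by omega⟩ : DiffPoly K (Fin (N - 1))) 0 g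
  have h2 := act_mono (MvPolynomial.C γ : DiffPoly K (Fin (N - 1))) 2 g
  rw [Nat.cast_zero] at h0
  rw [Nat.cast_ofNat] at h2
  rw [opA2, act_add_left, h0, h2, map_mul, incl_C, incl_C, incl_unk]
  rfl

theorem act_opA3 (hN : 4 ≤ N) (a b f c : K) (g : DiffPoly K (Option (Fin (N - 1)))) :
    act (opA3 hN a b f c) g = (MvPolynomial.C a * dx (unk (some ⟨0, by omega⟩)) +
      MvPolynomial.C b * unk (some ⟨1, by omega⟩)) * g +
      MvPolynomial.C f * unk (some ⟨0, by omega⟩) * dx g + MvPolynomial.C c * dx (dx (dx g)) := by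
  have h0 := act_mono (MvPolynomial.C a * dx (unk ⟨0, by omega⟩) +
    MvPolynomial.C b * unk ⟨1, by omega⟩ : DiffPoly K (Fin (N - 1))) 0 g
  have h1 := act_mono (MvPolynomial.C f * unk ⟨0, by omega⟩ : DiffPoly K (Fin (N - 1))) 1 g
  have h3 := act_mono (MvPolynomial.C c : DiffPoly K (Fin (N - 1))) 3 g
  rw [Nat.cast_zero] at h0
  rw [Nat.cast_one] at h1
  rw [Nat.cast_ofNat] at h3
  rw [opA3, act_add_left, act_add_left, h0, h1, h3]
  simp only [map_add, map_mul, incl_C, incl_unk, ← dx_incl]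
  rfl

variable (Q : Fin (N - 1) → DiffPoly K (Fin (N - 1))) (A : PsiDO (DiffPoly K (Fin (N - 1))))

theorem extFlow_unk (i : Fin (N - 1)) : extFlow Q A (unk (some i)) = incl (Q i) := by
  rw [← incl_unk, extFlow_incl, evol_unk]

/-- The flow is a derivation commuting with `dx`, so the only defect is the operator whose
coefficients are differentiated along the flow. -/
theorem extFlow_act_opA2 (hN : 4 ≤ N) (α γ : K) (g : DiffPoly K (Option (Fin (N - 1)))) :
    extFlow Q A (act (opA2 hN α γ) g) = act (opA2 hN α γ) (extFlow Q A g) +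
      MvPolynomial.C α * incl (Q ⟨0, by omega⟩) * g := by
  simp only [act_opA2, map_add, Derivation.leibniz, smul_eq_mul, MvPolynomial.derivation_C,
    extFlow_dx, extFlow_unk]
  ring

theorem extFlow_act_opA3 (hN : 4 ≤ N) (a b f c : K) (g : DiffPoly K (Option (Fin (N - 1)))) :
    extFlow Q A (act (opA3 hN a b f c) g) = act (opA3 hN a b f c) (extFlow Q A g) +
      (MvPolynomial.C a * dx (incl (Q ⟨0, by omega⟩)) +
        MvPolynomial.C b * incl (Q ⟨1, by omega⟩)) * g +
      MvPolynomial.C f * incl (Q ⟨0, by omega⟩) * dx g := by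
  simp only [act_opA3, map_add, Derivation.leibniz, smul_eq_mul, MvPolynomial.derivation_C,
    extFlow_dx, extFlow_unk]
  ring

theorem act_laxOp (hN : 4 ≤ N) (g : DiffPoly K (Option (Fin (N - 1)))) :
    act (laxOp K N) g = dx^[N] g +
      ∑ i : Fin (N - 1), unk (some i) * dx^[N - 2 - (i : ℕ)] g := by
  rw [laxOp, act_add_left, act_mono, map_one, one_mul, act_sum]
  congr 1
  refine Finset.sum_congr rfl fun i _ => ?_
  have h : (N : ℤ) - 2 - (i : ℕ) = ((N - 2 - (i : ℕ) : ℕ) : ℤ) := by omega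
  rw [h, act_mono, incl_unk]

theorem extFlow_iterate_dx (k : ℕ) (g : DiffPoly K (Option (Fin (N - 1)))) :
    extFlow Q A (dx^[k] g) = dx^[k] (extFlow Q A g) :=
  Function.Semiconj.iterate_right (f := extFlow Q A) (extFlow_dx Q A) k g

theorem extFlow_act_laxOp (hN : 4 ≤ N) (g : DiffPoly K (Option (Fin (N - 1)))) :
    extFlow Q A (act (laxOp K N) g) = act (laxOp K N) (extFlow Q A g) +
      act (∑ i : Fin (N - 1), mono (Q i) ((N : ℤ) - 2 - (i : ℕ))) g := by
  rw [act_laxOp hN, act_laxOp hN, act_sum, map_add, map_sum, extFlow_iterate_dx, add_assoc,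
    ← Finset.sum_add_distrib]
  congr 1
  refine Finset.sum_congr rfl fun i _ => ?_
  have h : (N : ℤ) - 2 - (i : ℕ) = ((N - 2 - (i : ℕ) : ℕ) : ℤ) := by omega
  rw [h, act_mono, Derivation.leibniz, extFlow_iterate_dx, extFlow_unk, smul_eq_mul, smul_eq_mul]
  ring

/-! ### The zero curvature equations and their solutions. -/

/-- The conditions on the constants under which the zero curvature equation
`X₂(A₃) - X₃(A₂) = [A₂, A₃]` holds. -/
structure ZeroCurvature (N : ℕ) (α γ a b f c : K) : Prop where
  eq₁ : 3 * α * c - 2 * γ * f = 0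
  eq₂ : 2 * f - 2 * γ * b = 0
  eq₃ : f * (2 - N) - 2 * γ * a - γ * f + 3 * α * c = 0
  eq₄ : 2 * b - 3 * α = 0
  eq₅ : 2 * a + b - α * (3 - 3 * ((N : K) - 1) / 2) - γ * b = 0
  eq₆ : α * f - b * (2 / (N : K) * (N - 2)) - α * (3 / (N : K) * (3 - N)) = 0
  eq₇ : a * (2 - N) - b * (((N : K) - 1) * (N - 2) / 3) -
    α * (1 - ((N : K) - 1) * (N - 2) / 2 - 3 * ((N : K) - 1) * (3 - N) / 4) - γ * a + α * c = 0

/-- The operator `X₂(A₃) - X₃(A₂) - [A₂, A₃]`, applied to `g`. -/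
def curvature (hN : 4 ≤ N) (α γ a b f c : K) (g : DiffPoly K (Option (Fin (N - 1)))) :
    DiffPoly K (Option (Fin (N - 1))) :=
  MvPolynomial.C (3 * α * c - 2 * γ * f) * (dx (unk (some ⟨0, by omega⟩)) * dx (dx g)) +
  MvPolynomial.C (2 * f - 2 * γ * b) * (dx (unk (some ⟨1, by omega⟩)) * dx g) +
  MvPolynomial.C (f * (2 - N) - 2 * γ * a - γ * f + 3 * α * c) *
    (dx (dx (unk (some ⟨0, by omega⟩))) * dx g) +
  MvPolynomial.C (2 * b - 3 * α) * (dx (unk (some ⟨2, by omega⟩)) * g) +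
  MvPolynomial.C (2 * a + b - α * (3 - 3 * ((N : K) - 1) / 2) - γ * b) *
    (dx (dx (unk (some ⟨1, by omega⟩))) * g) +
  MvPolynomial.C (α * f - b * (2 / (N : K) * (N - 2)) - α * (3 / (N : K) * (3 - N))) *
    (unk (some ⟨0, by omega⟩) * dx (unk (some ⟨0, by omega⟩)) * g) +
  MvPolynomial.C (a * (2 - N) - b * (((N : K) - 1) * (N - 2) / 3) -
    α * (1 - ((N : K) - 1) * (N - 2) / 2 - 3 * ((N : K) - 1) * (3 - N) / 4) - γ * a + α * c) *
    (dx (dx (dx (unk (some ⟨0, by omega⟩)))) * g)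

/-- The left side is `X₂(A₃) - X₃(A₂) - [A₂, A₃]` written out. It is stated for arbitrary `g`,
because the commutation of the flows on `u` needs it as an operator identity. -/
theorem curvature_eq [CharZero K] (hN : 4 ≤ N) (α γ a b f c : K)
    (g : DiffPoly K (Option (Fin (N - 1)))) :
    (MvPolynomial.C a * dx (incl (laxRhs K N 2 ⟨0, by omega⟩)) +
      MvPolynomial.C b * incl (laxRhs K N 2 ⟨1, by omega⟩)) * g +
      MvPolynomial.C f * incl (laxRhs K N 2 ⟨0, by omega⟩) * dx g -
      MvPolynomial.C α * incl (laxRhs K N 3 ⟨0, by omega⟩) * g +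
      act (opA3 hN a b f c) (act (opA2 hN α γ) g) - act (opA2 hN α γ) (act (opA3 hN a b f c) g) =
    curvature hN α γ a b f c g := by
  obtain ⟨h20, h21⟩ := laxRhs_two (K := K) hN
  have h30 := laxRhs_three (K := K) hN
  rw [h20, h21, h30, curvature]
  -- The identity holds for any values of these scalars, so they are made atoms for `ring`.
  generalize 2 / (N : K) * (N - 2) = k3
  generalize ((N : K) - 1) * (N - 2) / 3 = k2
  generalize 3 / (N : K) * (3 - N) = k6
  generalize (1 - ((N : K) - 1) * (N - 2) / 2 - 3 * ((N : K) - 1) * (3 - N) / 4) = k5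
  generalize (3 - 3 * ((N : K) - 1) / 2) = k4
  generalize (2 - (N : K)) = k1
  have h2 : ∀ {ι : Type} , dx (2 : DiffPoly K ι) = 0 := Derivation.map_natCast _ 2
  simp only [act_opA2, act_opA3, map_add, map_sub, map_mul, map_ofNat, incl_C, incl_unk, ← dx_incl,
    Derivation.leibniz, smul_eq_mul, dx_C, map_zero, h2]
  ring

theorem commutator_extFlow_phi [CharZero K] (hN : 4 ≤ N) (α γ a b f c : K) :
    ⁅extFlow (laxRhs K N 2) (opA2 hN α γ), extFlow (laxRhs K N 3) (opA3 hN a b f c)⁆ (unk none) =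
      curvature hN α γ a b f c (unk none) := by
  rw [Derivation.commutator_apply, extFlow_phi, extFlow_phi, applyPhi_eq_act, applyPhi_eq_act,
    extFlow_act_opA3, extFlow_act_opA2, extFlow_phi, extFlow_phi, applyPhi_eq_act, applyPhi_eq_act,
    ← curvature_eq]
  ring

theorem ZeroCurvature.curvature_eq_zero {hN : 4 ≤ N} {α γ a b f c : K}
    (h : ZeroCurvature N α γ a b f c) (g : DiffPoly K (Option (Fin (N - 1)))) :
    curvature hN α γ a b f c g = 0 := by
  rw [curvature, h.eq₁, h.eq₂, h.eq₃, h.eq₄, h.eq₅, h.eq₆, h.eq₇]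
  simp

/-- The seven monomials are distinct, and evaluating the jets at suitable 0-1 points isolates each
coefficient. -/
theorem zeroCurvature_of_curvature_eq_zero {hN : 4 ≤ N} {α γ a b f c : K}
    (h : curvature hN α γ a b f c (unk none) = 0) : ZeroCurvature N α γ a b f c := by
  have key : ∀ (U : ℕ → ℕ → K) (G : ℕ → K), _ := fun U G => congrArg (MvPolynomial.eval
    fun p : Option (Fin (N - 1)) × ℕ => p.1.elim (G p.2) fun i => U i p.2) h
  simp only [curvature, unk, dx_X, map_add, map_mul, MvPolynomial.eval_C, MvPolynomial.eval_X,
    Option.elim_some, Option.elim_none, map_zero] at key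
  -- Only the `k`-th derivative of `uᵢ` and the `j`-th derivative of `φ` are set to `1`; this
  -- handles the six monomials linear in `u`.
  have key' : ∀ (i k j : ℕ), _ := fun i k j =>
    key (fun i' k' => if i' = i ∧ k' = k then 1 else 0) fun j' => if j' = j then 1 else 0
  refine ⟨?_, ?_, ?_, ?_, ?_, ?_, ?_⟩
  · simpa using key' 0 1 2
  · simpa using key' 1 1 1
  · simpa using key' 0 2 1
  · simpa using key' 2 1 0
  · simpa using key' 1 2 0
  -- The quadratic monomial `u₀ u₀' φ` needs both `u₀` and `u₀'` equal to `1`.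
  · simpa using key (fun i k => if i = 0 ∧ k ≤ 1 then 1 else 0) fun j => if j = 0 then 1 else 0
  · simpa using key' 0 3 0

/-- The linear equations give `b`, `f` and `a` as multiples of `α` depending on `γ`. Hence `α ≠ 0`
can be cancelled from the others, which then fix `f = 3/N`, `c = γ²` and `γ² = 1`. -/
theorem ZeroCurvature.solve [CharZero K] (hN : 4 ≤ N) {α γ a b f c : K}
    (h : ZeroCurvature N α γ a b f c) (h0 : ¬ (α = 0 ∧ a = 0 ∧ b = 0 ∧ f = 0)) :
    (γ = 1 ∧ α = 2 / N ∧ a = 3 * (3 - (N : K)) / (2 * N) ∧ b = 3 / N ∧ f = 3 / N ∧ c = 1) ∨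
    (γ = -1 ∧ α = -(2 / N) ∧ a = 3 * ((N : K) - 1) / (2 * N) ∧ b = -(3 / N) ∧ f = 3 / N ∧
      c = 1) := by
  have hN0 : (N : K) ≠ 0 := Nat.cast_ne_zero.2 (by omega)
  obtain ⟨e1, e2, e3, e4, e5, e6, e7⟩ := h
  have hb : b = 3 * α / 2 := by linear_combination e4 / 2
  have hf : f = γ * b := by linear_combination e2 / 2
  have ha : a = 3 * α / 4 * (γ + 2 - N) := by
    rw [hb] at e5
    linear_combination e5 / 2
  have hα : α ≠ 0 := by
    rintro rfl
    exact h0 ⟨rfl, by simp [ha], by simp [hb], by simp [hf, hb]⟩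
  have hf' : f = 3 / N := by
    have : α * (f - 3 / N) = 0 := by
      rw [hb] at e6
      have hn : (N : K) / N = 1 := div_self hN0
      linear_combination e6
    rcases mul_eq_zero.1 this with h | h
    · exact absurd h hα
    · exact sub_eq_zero.1 h
  have hγα : γ * α = 2 / N := by
    rw [hf, hb] at hf'
    linear_combination (2 / 3) * hf'
  have hc : c = γ ^ 2 := by
    have : α * (c - γ ^ 2) = 0 := by
      rw [hf, hb] at e1
      linear_combination e1 / 3
    rcases mul_eq_zero.1 this with h | h
    · exact absurd h hα
    · exact sub_eq_zero.1 h
  have hγ : γ ^ 2 = 1 := by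
    -- After substitution `N` drops out of the last equation, which becomes `α (γ² - 1) / 4 = 0`.
    have : α * (γ ^ 2 - 1) = 0 := by
      rw [ha, hb, hc] at e7
      linear_combination 4 * e7
    rcases mul_eq_zero.1 this with h | h
    · exact absurd h hα
    · exact sub_eq_zero.1 h
  rw [hγ] at hc
  rcases mul_self_eq_one_iff.1 ((sq γ).symm.trans hγ) with rfl | rfl
  · left
    have hα' : α = 2 / N := by linear_combination hγα
    refine ⟨rfl, hα', ?_, ?_, hf', hc⟩
    · rw [ha, hα']; field_simp; ring
    · rw [hb, hα']; field_simp
  · right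
    have hα' : α = -(2 / N) := by linear_combination -hγα
    refine ⟨rfl, hα', ?_, ?_, hf', hc⟩
    · rw [ha, hα']; field_simp; ring
    · rw [hb, hα']; field_simp

theorem zeroCurvature_lax [CharZero K] (hN : 4 ≤ N) :
    ZeroCurvature N (2 / (N : K)) 1 (3 * (3 - (N : K)) / (2 * N)) (3 / N) (3 / N) 1 := by
  have hN0 : (N : K) ≠ 0 := Nat.cast_ne_zero.2 (by omega)
  constructor <;> field_simp <;> ring

theorem zeroCurvature_dual [CharZero K] (hN : 4 ≤ N) :
    ZeroCurvature N (-(2 / (N : K))) (-1) (3 * ((N : K) - 1) / (2 * N)) (-(3 / N)) (3 / N) 1 := by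
  have hN0 : (N : K) ≠ 0 := Nat.cast_ne_zero.2 (by omega)
  constructor <;> field_simp <;> ring

/-! ### Commutation of the second and third flows on `u`. -/

/-- The endomorphism by which an operator acts. -/
def actEnd (P : PsiDO (DiffPoly K (Fin (N - 1)))) :
    AddMonoid.End (DiffPoly K (Option (Fin (N - 1)))) :=
  AddMonoidHom.mk' (act P) (act_add_right P)

/-- The flow, as an additive endomorphism. -/
def flowEnd (Q : Fin (N - 1) → DiffPoly K (Fin (N - 1)))
    (A : PsiDO (DiffPoly K (Fin (N - 1)))) : AddMonoid.End (DiffPoly K (Option (Fin (N - 1)))) :=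
  AddMonoidHom.mk' (extFlow Q A) (map_add _)

/-- This is the Lax equation `Xₙ(L) = [A, L]` read as an identity of endomorphisms of `K{u, φ}`. -/
theorem commute_flowEnd_sub_actEnd (hN : 4 ≤ N) (n : ℕ)
    {A : PsiDO (DiffPoly K (Fin (N - 1)))} (hA : A.IsDifferential)
    (h : comm A (laxOp K N) =
      ∑ i : Fin (N - 1), mono (laxRhs K N n i) ((N : ℤ) - 2 - (i : ℕ))) :
    Commute (flowEnd (laxRhs K N n) A - actEnd A) (actEnd (laxOp K N)) := by
  refine AddMonoidHom.ext fun g => ?_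
  change extFlow (laxRhs K N n) A (act (laxOp K N) g) - act A (act (laxOp K N) g) =
    actEnd (laxOp K N) (extFlow (laxRhs K N n) A g - act A g)
  rw [map_sub]
  change _ = act (laxOp K N) (extFlow (laxRhs K N n) A g) - act (laxOp K N) (act A g)
  rw [extFlow_act_laxOp _ _ hN, ← h, PsiDO.comm, act_sub_left, act_mul hA isDifferential_laxOp,
    act_mul isDifferential_laxOp hA]
  ring

/-- The commutator of the Lax-type extensions commutes with the action of `L`. -/
theorem commutator_extFlow_act_laxOp [CharZero K] (hN : 4 ≤ N)
    (g : DiffPoly K (Option (Fin (N - 1)))) :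
    ⁅extFlow (laxRhs K N 2) (laxPlus K N 2), extFlow (laxRhs K N 3) (laxPlus K N 3)⁆
      (act (laxOp K N) g) = act (laxOp K N)
    (⁅extFlow (laxRhs K N 2) (laxPlus K N 2), extFlow (laxRhs K N 3) (laxPlus K N 3)⁆ g) := by
  have c2 := commute_flowEnd_sub_actEnd hN 2
    (by rw [← opA2_eq_laxPlus hN]; exact isDifferential_opA2 hN _ _) (comm_laxPlus_two (K := K) hN)
  have c3 := commute_flowEnd_sub_actEnd hN 3
    (by rw [← opA3_eq_laxPlus hN]; exact isDifferential_opA3 hN _ _ _ _)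
    (comm_laxPlus_three (K := K) hN)
  have c := (c2.mul_left c3).sub_left (c3.mul_left c2)
  set Y2 := flowEnd (laxRhs K N 2) (laxPlus K N 2)
  set Y3 := flowEnd (laxRhs K N 3) (laxPlus K N 3)
  -- Expanding the bracket on the left gives `[Y2, Y3]` plus the mixed terms and `[P₂, P₃]`, which
  -- cancel by zero curvature (`zc`).
  have key : (Y2 - actEnd (laxPlus K N 2)) * (Y3 - actEnd (laxPlus K N 3)) -
      (Y3 - actEnd (laxPlus K N 3)) * (Y2 - actEnd (laxPlus K N 2)) = Y2 * Y3 - Y3 * Y2 := by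
    have zc : Y2 * actEnd (laxPlus K N 3) - actEnd (laxPlus K N 3) * Y2 -
        (Y3 * actEnd (laxPlus K N 2) - actEnd (laxPlus K N 2) * Y3) =
        actEnd (laxPlus K N 2) * actEnd (laxPlus K N 3) -
        actEnd (laxPlus K N 3) * actEnd (laxPlus K N 2) := by
      refine AddMonoidHom.ext fun g => ?_
      change extFlow (laxRhs K N 2) (laxPlus K N 2) (act (laxPlus K N 3) g) -
        act (laxPlus K N 3) (extFlow (laxRhs K N 2) (laxPlus K N 2) g) -
        (extFlow (laxRhs K N 3) (laxPlus K N 3) (act (laxPlus K N 2) g) -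
        act (laxPlus K N 2) (extFlow (laxRhs K N 3) (laxPlus K N 3) g)) =
        act (laxPlus K N 2) (act (laxPlus K N 3) g) - act (laxPlus K N 3) (act (laxPlus K N 2) g)
      have h := curvature_eq hN (2 / (N : K)) 1 (3 * (3 - (N : K)) / (2 * N)) (3 / N) (3 / N) 1 g
      rw [(zeroCurvature_lax hN).curvature_eq_zero] at h
      rw [← opA2_eq_laxPlus hN, ← opA3_eq_laxPlus hN, extFlow_act_opA2, extFlow_act_opA3]
      linear_combination h
    have e : (Y2 - actEnd (laxPlus K N 2)) * (Y3 - actEnd (laxPlus K N 3)) -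
      (Y3 - actEnd (laxPlus K N 3)) * (Y2 - actEnd (laxPlus K N 2)) = Y2 * Y3 - Y3 * Y2 -
        (Y2 * actEnd (laxPlus K N 3) - actEnd (laxPlus K N 3) * Y2 -
        (Y3 * actEnd (laxPlus K N 2) - actEnd (laxPlus K N 2) * Y3)) +
        (actEnd (laxPlus K N 2) * actEnd (laxPlus K N 3) -
        actEnd (laxPlus K N 3) * actEnd (laxPlus K N 2)) := by
      simp only [sub_mul, mul_sub]
      abel
    rw [e, zc, sub_add_cancel]
  rw [key] at c
  exact DFunLike.congr_fun c.eq g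

/-- The second and the third flow commute. -/
theorem commutator_evol_laxRhs [CharZero K] (hN : 4 ≤ N) (i : Fin (N - 1)) :
    ⁅evol (laxRhs K N 2), evol (laxRhs K N 3)⁆ (unk i) = 0 := by
  set W := ⁅extFlow (laxRhs K N 2) (laxPlus K N 2), extFlow (laxRhs K N 3) (laxPlus K N 3)⁆
    with hW
  have hφ : W (unk none) = 0 := by
    rw [hW, ← opA2_eq_laxPlus hN, ← opA3_eq_laxPlus hN, commutator_extFlow_phi,
      (zeroCurvature_lax hN).curvature_eq_zero]
  have hD : ∀ k, W (dx^[k] (unk none)) = 0 := fun k => by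
    rw [hW, extFlow, extFlow, commutator_evol_iterate_dx]
    exact (congrArg _ hφ).trans (Function.iterate_fixed (map_zero _) k)
  have hu : ∀ j, W (unk (some j)) = incl (⁅evol (laxRhs K N 2), evol (laxRhs K N 3)⁆ (unk j)) := by
    intro j
    simp only [hW, Derivation.commutator_apply, ← incl_unk, extFlow_incl, map_sub]
  have h := commutator_extFlow_act_laxOp hN (unk none : DiffPoly K (Option (Fin (N - 1))))
  rw [← hW, hφ, act_laxOp hN, act_laxOp hN, map_add, map_sum, hD,
    Function.iterate_fixed (map_zero _)] at h
  have hX : ∀ k, W (MvPolynomial.X (none, k)) = 0 := fun k => by rw [← iterate_dx_unk, hD]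
  simp only [Derivation.leibniz, hX, hu, smul_eq_mul, iterate_dx_unk, zero_add,
    Function.iterate_fixed (map_zero _), mul_zero, Finset.sum_const_zero] at h
  -- The specialization `θ` sends `φ^{(N-2-i)}` to `1` and the other jets of `φ` to `0`, which
  -- extracts `W(uᵢ)` from the sum.
  let θ : DiffPoly K (Option (Fin (N - 1))) →ₐ[K] DiffPoly K (Fin (N - 1)) :=
    MvPolynomial.aeval fun p => p.1.elim (if p.2 = N - 2 - (i : ℕ) then 1 else 0)
      fun j => MvPolynomial.X (j, p.2)
  have hθ : ∀ f, θ (incl f) = f := by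
    intro f
    have : θ.comp incl = AlgHom.id K _ := by
      refine MvPolynomial.algHom_ext fun p => ?_
      rw [AlgHom.comp_apply, incl_X]
      exact MvPolynomial.aeval_X _ _
    exact DFunLike.congr_fun this f
  have hθ' : ∀ k, θ (MvPolynomial.X (none, k)) = if k = N - 2 - (i : ℕ) then 1 else 0 :=
    fun k => MvPolynomial.aeval_X _ _
  have h' := congrArg θ h
  simp only [map_sum, map_mul, hθ, hθ', map_zero] at h'
  rw [Finset.sum_eq_single i] at h'
  · simpa using h'
  · intro j _ hj
    rw [if_neg fun hji => hj (Fin.ext (by omega)), zero_mul]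
  · simp

/-! ### Commutation as zero curvature, and decomposed pairs. -/

theorem extCommute_iff [CharZero K] (hN : 4 ≤ N) (α γ a b f c : K) :
    ExtCommute (opA2 hN α γ) (opA3 hN a b f c) ↔ ZeroCurvature N α γ a b f c := by
  rw [ExtCommute]
  constructor
  · intro h
    apply zeroCurvature_of_curvature_eq_zero (hN := hN)
    rw [← commutator_extFlow_phi, h, Derivation.zero_apply]
  · intro h
    refine (commutator_evol_eq_zero_iff _ _).2 fun i => ?_
    match i with
    | none => exact (commutator_extFlow_phi hN α γ a b f c).trans (h.curvature_eq_zero _)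
    | some i =>
      have hi : ⁅extFlow (laxRhs K N 2) (opA2 hN α γ), extFlow (laxRhs K N 3) (opA3 hN a b f c)⁆
          (unk (some i)) = incl (⁅evol (laxRhs K N 2), evol (laxRhs K N 3)⁆ (unk i)) := by
        simp only [Derivation.commutator_apply, ← incl_unk, extFlow_incl, map_sub]
      exact hi.trans (by rw [commutator_evol_laxRhs hN, map_zero])

theorem decomposed_of_eq_zero (hN : 4 ≤ N) (γ c : K) :
    Decomposed (opA2 hN 0 γ) (opA3 hN 0 0 0 c) := by
  refine ⟨fun j => ⟨if j = 2 then γ else 0, ?_⟩, fun j => ⟨if j = 3 then c else 0, ?_⟩⟩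
  · simp only [opA2, coeff_add, coeff_mono, map_zero, zero_mul, ite_self, zero_add]
    split_ifs <;> simp
  · simp only [opA3, coeff_add, coeff_mono, map_zero, zero_mul, ite_self, zero_add]
    split_ifs <;> simp

theorem eq_zero_of_hasConstCoeffs_opA2 (hN : 4 ≤ N) {α γ : K}
    (h : HasConstCoeffs (opA2 hN α γ)) : α = 0 := by
  obtain ⟨c, hc⟩ := h 0
  simp only [opA2, coeff_add, coeff_mono, if_true, unk] at hc
  rw [if_neg (by norm_num), add_zero] at hc
  -- At the zero point `α u₀ = c` gives `c = 0`; at the point with all coordinates `1` it gives `α =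
  -- c`.
  have h0 := congrArg (MvPolynomial.eval fun _ => (0 : K)) hc
  have h1 := congrArg (MvPolynomial.eval fun _ => (1 : K)) hc
  simp at h0 h1
  rw [h1, ← h0]

end LaxHierarchy

end

open LaxHierarchy in
theorem mainTheorem2 {K : Type*} [Field K] [CharZero K] {N : ℕ} (hN : 4 ≤ N) :
    (∀ α γ a b f g : K,
      (ExtCommute (opA2 hN α γ) (opA3 hN a b f g) ∧
          ¬ Decomposed (opA2 hN α γ) (opA3 hN a b f g)) ↔
        (γ = 1 ∧ opA2 hN α γ = laxPlus K N 2 ∧ opA3 hN a b f g = laxPlus K N 3) ∨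
        (γ = -1 ∧ opA2 hN α γ = -(laxPlus K N 2).adjoint ∧
          opA3 hN a b f g = -(laxPlus K N 3).adjoint)) ∧
    (opA2 hN (2 / (N : K)) 1 = laxPlus K N 2 ∧
      opA3 hN (3 * (3 - (N : K)) / (2 * (N : K))) (3 / (N : K)) (3 / (N : K)) 1 = laxPlus K N 3) ∧
    (opA2 hN (-(2 / (N : K))) (-1) = -(laxPlus K N 2).adjoint ∧
      opA3 hN (3 * ((N : K) - 1) / (2 * (N : K))) (-(3 / (N : K))) (3 / (N : K)) 1 = -(laxPlus K N 3).adjoint) := by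
  have hN0 : (N : K) ≠ 0 := Nat.cast_ne_zero.2 (by omega)
  refine ⟨fun α γ a b f g => ⟨fun ⟨hc, hd⟩ => ?_, ?_⟩,
    ⟨opA2_eq_laxPlus hN, opA3_eq_laxPlus hN⟩, opA2_eq_neg_adjoint hN, opA3_eq_neg_adjoint hN⟩
  · rw [extCommute_iff] at hc
    rcases hc.solve hN (by
      rintro ⟨rfl, rfl, rfl, rfl⟩
      exact hd (decomposed_of_eq_zero hN _ _)) with
      ⟨rfl, rfl, rfl, rfl, rfl, rfl⟩ | ⟨rfl, rfl, rfl, rfl, rfl, rfl⟩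
    · exact Or.inl ⟨rfl, opA2_eq_laxPlus hN, opA3_eq_laxPlus hN⟩
    · exact Or.inr ⟨rfl, opA2_eq_neg_adjoint hN, opA3_eq_neg_adjoint hN⟩
  · rintro (⟨-, h2, h3⟩ | ⟨-, h2, h3⟩)
    · rw [h2, h3, ← opA2_eq_laxPlus hN, ← opA3_eq_laxPlus hN, extCommute_iff]
      refine ⟨zeroCurvature_lax hN, fun hd => ?_⟩
      -- A decomposed pair would have `α = 0`, whereas here `α = 2/N`.
      simpa [hN0] using eq_zero_of_hasConstCoeffs_opA2 hN hd.1
    · rw [h2, h3, ← opA2_eq_neg_adjoint hN, ← opA3_eq_neg_adjoint hN, extCommute_iff]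
      refine ⟨zeroCurvature_dual hN, fun hd => ?_⟩
      simpa [hN0] using eq_zero_of_hasConstCoeffs_opA2 hN hd.1
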